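/- Let $X$ be a CAT(0) space, and for a CAT(0) space $Z$ let $\partial Z$ denote its boundary (the set of asymptoty classes of geodesic rays), endowed with the cone topology when it is considered as a topological space (the visual boundary). Let a group $G$ act geometrically (that is, properly and cocompactly by isometries) on $X$. Suppose that there are closed convex subspaces $X_1,\dots,X_n$ of $X$ such that $$\partial X=\partial X_1*\cdots*\partial X_n ,$$ that is, for the angular (Tits angle) metrics, $\partial X$ is the spherical join of its subsets $\partial X_1,\dots,\partial X_n$: the inclusions $\partial X_i\subseteq\partial X$ extend to a bijection from the set of formal combinations $\sum_i w_i\xi_i$ (with $w_i\ge 0$, $\sum_i w_i^2=1$, $\xi_i\in\partial X_i$, where $\xi_i$ is disregarded if $w_i=0$) onto $\partial X$ such that $$\cos\angle\Big(\sum_i w_i\xi_i,\ \sum_i v_i\eta_i\Big)=\sum_i w_iv_i\cos\angle(\xi_i,\eta_i).$$ Suppose that each of the visual boundaries $\partial X_1,\dots,\partial X_n$ has topological dimension zero. If $|\partial X_i|\ge 3$, then $\partial X_i$ is homeomorphic to the Cantor set. -/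

import Mathlib

open scoped NNReal

/-! ### CAT(0) spaces and geometric actions -/

/-- A CAT(0) space: a geodesic metric space in which geodesic triangles are no fatter than their
Euclidean comparison triangles. A point `x` with `dist p x + dist x q = dist p q` is the same thing
as a point on some geodesic segment from `p` to `q`. In the inequality `x` and `y` lie on two sides
issuing from the vertex `p`, and `p'`, `q'`, `r'`, `x'`, `y'` are their comparison points. -/
structure IsCAT0 (X : Type*) [MetricSpace X] : Prop where
  geodesic : ∀ x y : X, ∃ γ : ℝ → X, γ 0 = x ∧ γ (dist x y) = y ∧
    ∀ s ∈ Set.Icc 0 (dist x y), ∀ t ∈ Set.Icc 0 (dist x y), dist (γ s) (γ t) = |s - t|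
  comparison : ∀ (p q r x y : X) (p' q' r' x' y' : EuclideanSpace ℝ (Fin 2)),
    dist p' q' = dist p q → dist q' r' = dist q r → dist r' p' = dist r p →
    dist p x + dist x q = dist p q → dist p y + dist y r = dist p r →
    dist p' x' = dist p x → dist x' q' = dist x q →
    dist p' y' = dist p y → dist y' r' = dist y r →
    dist x y ≤ dist x' y'

/-- A geometric action: properly and cocompactly by isometries. Proper means that every point has a
ball that meets only finitely many of its translates. -/
structure IsGeometricAction (G X : Type*) [Group G] [MetricSpace X] [MulAction G X] : Prop where
  isometry : ∀ g : G, Isometry (fun x : X => g • x)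
  proper : ∀ x : X, ∃ r > 0,
    {g : G | (((fun y : X => g • y) '' Metric.ball x r) ∩ Metric.ball x r).Nonempty}.Finite
  cocompact : ∃ K : Set X, IsCompact K ∧ ⋃ g : G, (fun y : X => g • y) '' K = Set.univ

/-- A geodesically convex subset: it contains every geodesic segment between two of its points. -/
def IsGeodesicallyConvex {X : Type*} [MetricSpace X] (Y : Set X) : Prop :=
  ∀ x ∈ Y, ∀ y ∈ Y, ∀ z : X, dist x z + dist z y = dist x y → z ∈ Y

/-! ### The boundary -/

/-- Geodesic rays `[0, ∞) → X`. -/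
def GeodesicRay (X : Type*) [MetricSpace X] : Type _ := {r : ℝ≥0 → X // Isometry r}

instance (X : Type*) [MetricSpace X] : CoeFun (GeodesicRay X) (fun _ => ℝ≥0 → X) :=
  ⟨Subtype.val⟩

/-- Two rays are asymptotic if they stay at bounded distance from each other. -/
def Asymptotic {X : Type*} [MetricSpace X] (r r' : GeodesicRay X) : Prop :=
  ∃ K : ℝ, ∀ t : ℝ≥0, dist (r t) (r' t) ≤ K

/-- Being asymptotic is an equivalence relation. -/
def asymptoticSetoid (X : Type*) [MetricSpace X] : Setoid (GeodesicRay X) where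
  r := Asymptotic
  iseqv :=
    { refl := fun r => ⟨0, fun t => by simp⟩
      symm := fun ⟨K, hK⟩ => ⟨K, fun t => by rw [dist_comm]; exact hK t⟩
      trans := fun ⟨K, hK⟩ ⟨L, hL⟩ =>
        ⟨K + L, fun t => (dist_triangle _ _ _).trans (add_le_add (hK t) (hL t))⟩ }

/-- The boundary of `X` as a set: asymptoty classes of geodesic rays. -/
def Boundary (X : Type*) [MetricSpace X] : Type _ := Quotient (asymptoticSetoid X)

/-- The endpoint `r(∞)` of a ray. -/
def GeodesicRay.endpoint {X : Type*} [MetricSpace X] (r : GeodesicRay X) : Boundary X :=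
  Quotient.mk (asymptoticSetoid X) r

/-- The visual boundary: the boundary, to be endowed with the cone topology at `x₀`. (In a complete
CAT(0) space this topology does not depend on `x₀`.) -/
def VisualBoundary (X : Type*) [MetricSpace X] (_x₀ : X) : Type _ := Boundary X

/-- The cone topology with respect to `x₀`, generated by the sets
`U(r, R, ε) = {r'(∞) : r'(0) = x₀, d(r(R), r'(R)) < ε}`, where `r` is a ray from `x₀`. -/
instance (X : Type*) [MetricSpace X] (x₀ : X) : TopologicalSpace (VisualBoundary X x₀) :=
  TopologicalSpace.generateFrom
    {U : Set (Boundary X) | ∃ (r : GeodesicRay X) (R : ℝ≥0) (ε : ℝ), r 0 = x₀ ∧ 0 < R ∧ 0 < ε ∧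
      U = {ξ | ∃ r' : GeodesicRay X, r'.endpoint = ξ ∧ r' 0 = x₀ ∧ dist (r R) (r' R) < ε}}

/-- The natural map from the boundary of a subspace `Y` of `X` to the boundary of `X`. -/
def boundaryIncl {X : Type*} [MetricSpace X] (Y : Set X) : Boundary Y → Boundary X :=
  Quotient.map (sa := asymptoticSetoid Y) (sb := asymptoticSetoid X)
    (fun r => ⟨fun t => (r t : X), isometry_subtype_coe.comp r.2⟩)
    (fun _ _ ⟨K, hK⟩ => ⟨K, hK⟩)

/-! ### The angular metric and the spherical join -/

/-- The angle at infinity (Tits angle) `∠(ξ, η) ∈ [0, π]`: the supremum of the Euclidean comparison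
angles at `x` of the triangles `x, r(s), r'(t)`, where `s, t > 0` and where `r` and `r'` are rays
from a common origin `x` to `ξ` and to `η`. (In a CAT(0) space the comparison angle is nondecreasing
in `s` and `t`, so that the supremum is a limit, and in a complete one every origin gives the same
value.) -/
noncomputable def titsAngle {X : Type*} [MetricSpace X] (ξ η : Boundary X) : ℝ :=
  sSup {a : ℝ | ∃ (r r' : GeodesicRay X) (s t : ℝ≥0),
    r.endpoint = ξ ∧ r'.endpoint = η ∧ r 0 = r' 0 ∧ 0 < s ∧ 0 < t ∧
    a = Real.arccos (((s : ℝ) ^ 2 + (t : ℝ) ^ 2 - dist (r s) (r' t) ^ 2) / (2 * s * t))}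

/-- The points of the spherical join `A₁ * … * Aₙ`: formal combinations `∑ wᵢ aᵢ` with `wᵢ ≥ 0` and
`∑ wᵢ² = 1`, where `aᵢ ∈ Aᵢ` is recorded only if `wᵢ ≠ 0`. -/
structure SphericalJoin {n : ℕ} (A : Fin n → Type*) where
  weight : Fin n → ℝ
  weight_nonneg : ∀ i, 0 ≤ weight i
  sum_sq : ∑ i, weight i ^ 2 = 1
  pt : ∀ i, weight i ≠ 0 → A i

open Classical in
/-- The metric of the spherical join of spaces with angular metrics `ang i`:
`cos d(∑ wᵢ aᵢ, ∑ vᵢ bᵢ) = ∑ wᵢ vᵢ cos (ang i aᵢ bᵢ)`. -/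
noncomputable def SphericalJoin.angle {n : ℕ} {A : Fin n → Type*} (ang : ∀ i, A i → A i → ℝ)
    (p q : SphericalJoin A) : ℝ :=
  Real.arccos (∑ i, if h : p.weight i ≠ 0 ∧ q.weight i ≠ 0 then
    p.weight i * q.weight i * Real.cos (ang i (p.pt i h.1) (q.pt i h.2)) else 0)

/-- `∂X = ∂Y₁ * … * ∂Yₙ` for subspaces `Yᵢ` of `X`: the inclusions of the `∂Yᵢ` into `∂X` extend to
an isometry of the spherical join of the `∂Yᵢ` onto `∂X`, for the angular metrics. -/
def BoundaryIsJoin {X : Type*} [MetricSpace X] {n : ℕ} (Y : Fin n → Set X) : Prop :=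
  ∃ Φ : SphericalJoin (fun i => Boundary (Y i)) ≃ Boundary X,
    (∀ p q, titsAngle (Φ p) (Φ q) = SphericalJoin.angle (fun _ => titsAngle) p q) ∧
    ∀ p i (h : p.weight i = 1), Φ p = boundaryIncl (Y i) (p.pt i (by rw [h]; exact one_ne_zero))

/-! A geometric action makes `X` proper, so each ∂Xᵢ is compact, Hausdorff and second countable, and
dimension zero gives it a clopen basis. By Brouwer's characterization
(`nonempty_homeomorph_cantorSet`) it remains to exclude isolated points
(`IsJoinOfDiscrete.not_isOpen_singleton`).

The topology determines the angles. Two points of ∂Xᵢ at angle less than π are linked at infinity by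
segments that stay far from the base point, so no clopen set separates them
(`IsCAT0.titsAngle_eq_pi`). Hence distinct points of ∂Xᵢ are at angle π, and ∂X is a spherical join
of discrete factors. There the factors with at least three points can be recognized from the angles
alone, so the elements of `G` permute them (`IsJoinOfDiscrete.exists_apply_boundaryIncl_eq`).

Let ξ be isolated in ∂Xᵢ, and choose gₖ with gₖx at bounded distance from the k-th point of the ray
to ξ. Along an ultrafilter, gₖ carries one fixed factor ∂Xⱼ with at least three points into ∂Xᵢ. For
η in ∂Xⱼ let ζ(η) in ∂Xᵢ be the limit of gₖη. If ζ(η) = ξ, then gₖη = ξ for most k, which happens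
for at most one η. If ζ(η) ≠ ξ, then gₖη and gₖx have limits at angle π, and a comparison estimate
(`IsCAT0.eventually_dist_le_of_titsAngle_eq_pi`) shows that gₖ⁻¹x tends to η, which again happens
for at most one η. So ∂Xⱼ has at most two points, a contradiction. -/

open Filter Topology

/-! ### Brouwer's characterization of the Cantor set -/

section Brouwer

variable {K : Type*} (S : Set K → ℕ → Set K)

/-- The cell of depth `n` containing `x`, when every cell `D` of depth `m` is cut in two by
`S D m`. -/
def cutCell (x : K) : ℕ → Set K
  | 0 => Set.univ
  | n + 1 => {z ∈ cutCell x n | z ∈ S (cutCell x n) n ↔ x ∈ S (cutCell x n) n}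

open Classical in
/-- The itinerary of `x` in the binary tree of cells. -/
noncomputable def cutCode (x : K) (n : ℕ) : Bool := decide (x ∈ S (cutCell S x n) n)

/-- The cell with a given itinerary. -/
def codeCell (b : ℕ → Bool) : ℕ → Set K
  | 0 => Set.univ
  | n + 1 => {z ∈ codeCell b n | z ∈ S (codeCell b n) n ↔ b n = true}

lemma mem_cutCell (x : K) (n : ℕ) : x ∈ cutCell S x n := by
  induction n with
  | zero => trivial
  | succ n ih => exact ⟨ih, Iff.rfl⟩

lemma cutCell_eq_codeCell (x : K) (n : ℕ) : cutCell S x n = codeCell S (cutCode S x) n := by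
  induction n with
  | zero => rfl
  | succ n ih =>
    simp only [cutCell, codeCell, ← ih, cutCode, decide_eq_true_eq]

lemma cutCell_eq_of_mem_codeCell {x : K} {b : ℕ → Bool} (h : ∀ n, x ∈ codeCell S b n) (n : ℕ) :
    cutCell S x n = codeCell S b n := by
  induction n with
  | zero => rfl
  | succ n ih =>
    have := (h (n + 1)).2
    simp only [cutCell, codeCell, ih, this]

lemma cutCell_eq_of_mem {x z : K} {n : ℕ} (h : z ∈ cutCell S x n) :
    cutCell S z n = cutCell S x n := by
  induction n with
  | zero => rfl
  | succ n ih =>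
    have h1 := ih h.1
    have h2 := h.2
    simp only [cutCell, h1, h2]

variable [TopologicalSpace K]

lemma isClopen_setOf_mem_iff {A B : Set K} (hA : IsClopen A) (hB : IsClopen B) (p : Prop) :
    IsClopen {z ∈ A | z ∈ B ↔ p} := by
  by_cases hp : p
  · simp only [hp, iff_true]; exact hA.inter hB
  · simp only [hp, iff_false]; exact hA.inter hB.compl

variable {S}

lemma isClopen_codeCell (hS : ∀ D n, IsClopen (S D n)) (b : ℕ → Bool) (n : ℕ) :
    IsClopen (codeCell S b n) := by
  induction n with
  | zero => exact isClopen_univ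
  | succ n ih => exact isClopen_setOf_mem_iff ih (hS _ _) _

lemma nonempty_codeCell [Nonempty K] (hS : ∀ D n, IsClopen (S D n))
    (hcut : ∀ D n, IsClopen D → D.Nonempty → (D ∩ S D n).Nonempty ∧ (D \ S D n).Nonempty)
    (b : ℕ → Bool) (n : ℕ) : (codeCell S b n).Nonempty := by
  induction n with
  | zero => exact Set.univ_nonempty
  | succ n ih =>
    obtain ⟨⟨u, hu⟩, ⟨v, hv⟩⟩ := hcut _ n (isClopen_codeCell hS b n) ih
    cases hb : b n
    · exact ⟨v, hv.1, by simp [hb, hv.2]⟩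
    · exact ⟨u, hu.1, by simp [hb, hu.2]⟩

/-- Brouwer's characterization of the Cantor set. -/
theorem nonempty_homeomorph_cantorSet [CompactSpace K] [T2Space K] [SecondCountableTopology K]
    [Nonempty K] (hbasis : TopologicalSpace.IsTopologicalBasis {s : Set K | IsClopen s})
    (hperfect : ∀ x : K, ¬ IsOpen ({x} : Set K)) : Nonempty (K ≃ₜ cantorSet) := by
  have hsep : ∀ x y : K, x ≠ y → ∃ U : Set K, IsClopen U ∧ x ∈ U ∧ y ∉ U := by
    intro x y hxy
    obtain ⟨U, hU, hxU, hUy⟩ := hbasis.exists_subset_of_mem_open (u := {y}ᶜ)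
      (by simpa using hxy) isOpen_compl_singleton
    exact ⟨U, hU, hxU, fun h => hUy h rfl⟩
  have : TotallySeparatedSpace K :=
    totallySeparatedSpace_iff_exists_isClopen.mpr fun x y hxy => hsep x y hxy
  have : Countable (TopologicalSpace.Clopens K) :=
    TopologicalSpace.Clopens.countable_iff_secondCountable.2 inferInstance
  obtain ⟨C, hC⟩ := exists_surjective_nat (TopologicalSpace.Clopens K)
  -- The `n`-th clopen set is used whenever it really cuts `D`, so that the cells end up separating
  -- points. Otherwise any clopen splitting serves; one exists because `D`, being open, is not a
  -- singleton. Nonempty halves keep every branch of the tree alive.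
  have hcut : ∀ (D : Set K) (n : ℕ), ∃ S : Set K, IsClopen S ∧
      (IsClopen D → D.Nonempty → (D ∩ S).Nonempty ∧ (D \ S).Nonempty) ∧
      ((D ∩ C n).Nonempty → (D \ C n).Nonempty → S = C n) := by
    intro D n
    by_cases h : (D ∩ C n).Nonempty ∧ (D \ C n).Nonempty
    · exact ⟨C n, (C n).isClopen, fun _ _ => h, fun _ _ => rfl⟩
    by_cases hD : IsClopen D ∧ D.Nonempty
    · obtain ⟨hD, x, hx⟩ := hD
      have : ∃ y ∈ D, y ≠ x := by
        by_contra! hne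
        apply hperfect x
        have : D = {x} := Set.eq_singleton_iff_unique_mem.2 ⟨hx, hne⟩
        exact this ▸ hD.isOpen
      obtain ⟨y, hy, hyx⟩ := this
      obtain ⟨U, hU, hyU, hxU⟩ := hsep y x hyx
      exact ⟨U, hU, fun _ _ => ⟨⟨y, hy, hyU⟩, ⟨x, hx, hxU⟩⟩, fun h1 h2 => (h ⟨h1, h2⟩).elim⟩
    · exact ⟨∅, isClopen_empty, fun h1 h2 => (hD ⟨h1, h2⟩).elim,
        fun h1 h2 => (h ⟨h1, h2⟩).elim⟩
  choose S hS hS1 hS2 using hcut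
  have hcont : Continuous (cutCode S) := by
    refine continuous_pi fun n => ?_
    rw [IsLocallyConstant.iff_continuous _ |>.symm, IsLocallyConstant.iff_exists_open]
    intro x
    refine ⟨cutCell S x (n + 1), ?_, mem_cutCell S x _, ?_⟩
    · rw [cutCell_eq_codeCell]
      exact (isClopen_codeCell hS _ _).isOpen
    · intro z hz
      have h1 := cutCell_eq_of_mem S hz.1
      have h2 := hz.2
      unfold cutCode; rw [h1, decide_eq_decide]; exact h2
  have hinj : Function.Injective (cutCode S) := by
    intro x y hxy
    by_contra hne
    -- `U` is some `C n`. If `x` and `y` still share a cell at depth `n`, that cell is cut along `U`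
    -- at this very step.
    obtain ⟨U, hU, hxU, hyU⟩ := hsep x y hne
    obtain ⟨n, hn⟩ := hC ⟨U, hU⟩
    have hcell : cutCell S x n = cutCell S y n := by
      rw [cutCell_eq_codeCell, cutCell_eq_codeCell, hxy]
    have hCn : (C n : Set K) = U := by rw [hn]; rfl
    have hS' : S (cutCell S x n) n = U := by
      rw [← hCn]
      apply hS2
      · exact ⟨x, mem_cutCell S x n, by rwa [hCn]⟩
      · exact ⟨y, hcell ▸ mem_cutCell S y n, by rwa [hCn]⟩
    have h1 := congrFun hxy n
    simp only [cutCode, ← hcell, hS', decide_eq_decide] at h1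
    exact hyU (h1.1 hxU)
  have hsurj : Function.Surjective (cutCode S) := by
    intro b
    have hne : (⋂ n, codeCell S b n).Nonempty := by
      apply IsCompact.nonempty_iInter_of_sequence_nonempty_isCompact_isClosed
      · exact fun n z hz => hz.1
      · exact nonempty_codeCell hS hS1 b
      · exact (isClopen_codeCell hS b 0).isClosed.isCompact
      · exact fun n => (isClopen_codeCell hS b n).isClosed
    obtain ⟨x, hx⟩ := hne
    rw [Set.mem_iInter] at hx
    refine ⟨x, funext fun n => ?_⟩
    have h1 := cutCell_eq_of_mem_codeCell S hx n
    have h2 := (hx (n + 1)).2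
    rw [Bool.eq_iff_iff, ← h2]
    simp only [cutCode, h1, decide_eq_true_eq]
  exact ⟨(hcont.homeoOfEquivCompactToT2 (f := Equiv.ofBijective _ ⟨hinj, hsurj⟩)).trans
    cantorSetHomeomorphNatToBool.symm⟩

end Brouwer

/-! ### Comparison inequalities -/

section CAT0

variable {X : Type*} [MetricSpace X]

/-- `x` is the point at distance `T` from `p` on a geodesic segment from `p` to `q`. -/
def IsPointAt (p q : X) (T : ℝ) (x : X) : Prop :=
  dist p x = T ∧ dist x q = dist p q - T

lemma IsPointAt.nonneg {p q x : X} {T : ℝ} (h : IsPointAt p q T x) : 0 ≤ T := h.1 ▸ dist_nonneg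

lemma IsPointAt.le {p q x : X} {T : ℝ} (h : IsPointAt p q T x) : T ≤ dist p q := by
  have := h.2 ▸ dist_nonneg (x := x) (y := q)
  linarith

lemma IsCAT0.exists_isPointAt (hX : IsCAT0 X) {p q : X} {T : ℝ} (h0 : 0 ≤ T) (h1 : T ≤ dist p q) :
    ∃ x, IsPointAt p q T x := by
  obtain ⟨γ, hγ0, hγ1, hγ⟩ := hX.geodesic p q
  refine ⟨γ T, ?_, ?_⟩
  · rw [← hγ0, hγ 0 ⟨le_rfl, dist_nonneg⟩ T ⟨h0, h1⟩, zero_sub, abs_neg, abs_of_nonneg h0]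
  · conv_lhs => rw [← hγ1]
    rw [hγ T ⟨h0, h1⟩ _ ⟨dist_nonneg, le_rfl⟩, abs_sub_comm, abs_of_nonneg (by linarith)]

/-- The third vertex of the triangle on (0, 0) and (a, 0): the law of cosines fixes `u`, and the
triangle inequalities give u² ≤ b², which leaves room for `v`. -/
lemma exists_comparison_triangle {a b c : ℝ} (ha : 0 < a) (hb : 0 ≤ b) (hc : 0 ≤ c)
    (h1 : a ≤ b + c) (h2 : b ≤ a + c) (h3 : c ≤ a + b) :
    ∃ u v : ℝ, u ^ 2 + v ^ 2 = b ^ 2 ∧ 2 * a * u = a ^ 2 + b ^ 2 - c ^ 2 := by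
  set u := (a ^ 2 + b ^ 2 - c ^ 2) / (2 * a) with hu
  have hu' : 2 * a * u = a ^ 2 + b ^ 2 - c ^ 2 := by rw [hu]; field_simp
  have hub : u ^ 2 ≤ b ^ 2 := by
    apply sq_le_sq'
    · by_contra! h
      nlinarith
    · by_contra! h
      nlinarith
  exact ⟨u, √(b ^ 2 - u ^ 2), by rw [Real.sq_sqrt (by linarith)]; ring, hu'⟩

lemma EuclideanSpace.dist_fin_two (a b c d : ℝ) :
    dist (!₂[a, b] : EuclideanSpace ℝ (Fin 2)) !₂[c, d] = √((a - c) ^ 2 + (b - d) ^ 2) := by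
  simp [EuclideanSpace.dist_eq, Real.dist_eq, Fin.sum_univ_two]

/-- The CAT(0) inequality for points on two sides of a triangle, in terms of side lengths. -/
theorem IsCAT0.dist_sq_le (hX : IsCAT0 X) {p q r x y : X} {α β : ℝ}
    (hα : 0 ≤ α) (hα1 : α ≤ 1) (hβ : 0 ≤ β) (hβ1 : β ≤ 1)
    (hx : IsPointAt p q (α * dist p q) x) (hy : IsPointAt p r (β * dist p r) y) :
    dist x y ^ 2 ≤ α ^ 2 * dist p q ^ 2 + β ^ 2 * dist p r ^ 2
      - α * β * (dist p q ^ 2 + dist p r ^ 2 - dist q r ^ 2) := by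
  rcases eq_or_ne p q with rfl | hpq
  · have hx0 : p = x := by simpa using hx.1
    have := hy.1
    rw [← hx0, this]
    simp only [dist_self]
    nlinarith
  set a := dist p q with ha
  set b := dist p r with hb
  set c := dist q r with hc
  have ha0 : 0 < a := dist_pos.2 hpq
  have hb0 : 0 ≤ b := dist_nonneg
  have t1 : a ≤ b + c := by
    rw [ha, hb, hc, dist_comm q r]; exact dist_triangle _ _ _
  have t2 : b ≤ a + c := dist_triangle _ _ _
  have t3 : c ≤ a + b := by
    rw [ha, hb, hc, dist_comm p q]; exact dist_triangle _ _ _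
  obtain ⟨u, v, huv, hu⟩ := exists_comparison_triangle ha0 hb0 dist_nonneg t1 t2 t3
  have key := hX.comparison p q r x y !₂[0, 0] !₂[a, 0] !₂[u, v] !₂[α * a, 0] !₂[β * u, β * v]
    (by rw [EuclideanSpace.dist_fin_two]
        rw [show (0 - a) ^ 2 + (0 - 0) ^ 2 = a ^ 2 by ring, Real.sqrt_sq ha0.le])
    (by rw [EuclideanSpace.dist_fin_two]
        rw [show (a - u) ^ 2 + (0 - v) ^ 2 = c ^ 2 by linear_combination huv - hu,
          Real.sqrt_sq dist_nonneg])
    (by rw [EuclideanSpace.dist_fin_two, dist_comm r p]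
        rw [show (u - 0) ^ 2 + (v - 0) ^ 2 = b ^ 2 by linear_combination huv,
          Real.sqrt_sq dist_nonneg])
    (by rw [hx.1, hx.2]; ring)
    (by rw [hy.1, hy.2]; ring)
    (by rw [EuclideanSpace.dist_fin_two, hx.1]
        rw [show (0 - α * a) ^ 2 + (0 - 0) ^ 2 = (α * a) ^ 2 by ring,
          Real.sqrt_sq (by positivity)])
    (by rw [EuclideanSpace.dist_fin_two, hx.2]
        rw [show (α * a - a) ^ 2 + (0 - 0) ^ 2 = (a - α * a) ^ 2 by ring,
          Real.sqrt_sq (by nlinarith)])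
    (by rw [EuclideanSpace.dist_fin_two, hy.1]
        rw [show (0 - β * u) ^ 2 + (0 - β * v) ^ 2 = (β * b) ^ 2 by
          linear_combination β ^ 2 * huv, Real.sqrt_sq (by positivity)])
    (by rw [EuclideanSpace.dist_fin_two, hy.2]
        rw [show (β * u - u) ^ 2 + (β * v - v) ^ 2 = (b - β * b) ^ 2 by
          linear_combination (β - 1) ^ 2 * huv, Real.sqrt_sq (by nlinarith)])
  rw [EuclideanSpace.dist_fin_two] at key
  have h2 := pow_le_pow_left₀ dist_nonneg key 2
  rw [Real.sq_sqrt (by positivity)] at h2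
  refine h2.trans (le_of_eq ?_)
  linear_combination β ^ 2 * huv - α * β * hu

/-- Points at the same distance from the common endpoint of two geodesic segments. -/
theorem IsCAT0.dist_sq_mul_le (hX : IsCAT0 X) {p q r x y : X} {T : ℝ}
    (hx : IsPointAt p q T x) (hy : IsPointAt p r T y) :
    dist x y ^ 2 * (dist p q * dist p r) ≤
      T ^ 2 * (dist q r ^ 2 - (dist p q - dist p r) ^ 2) := by
  have hq := hx.le
  have hr := hy.le
  have hT := hx.nonneg
  rcases hT.eq_or_lt with rfl | hT
  · have h1 : p = x := by simpa using hx.1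
    have h2 : p = y := by simpa using hy.1
    simp [← h1, ← h2]
  have hq0 := hT.trans_le hq
  have hr0 := hT.trans_le hr
  have hα : T / dist p q * dist p q = T := by field_simp
  have hβ : T / dist p r * dist p r = T := by field_simp
  have key := hX.dist_sq_le (p := p) (q := q) (r := r) (x := x) (y := y) (α := T / dist p q)
    (β := T / dist p r) (by positivity) ((div_le_one hq0).2 hq) (by positivity)
    ((div_le_one hr0).2 hr) (by rwa [hα]) (by rwa [hβ])
  have h2 := mul_le_mul_of_nonneg_right key (mul_pos hq0 hr0).le
  refine h2.trans (le_of_eq ?_)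
  field_simp
  ring

lemma IsCAT0.dist_sq_mul_le' (hX : IsCAT0 X) {p q r x y : X} {T : ℝ}
    (hx : IsPointAt p q T x) (hy : IsPointAt p r T y) :
    dist x y ^ 2 * (dist p q * dist p r) ≤ (T * dist q r) ^ 2 := by
  have := hX.dist_sq_mul_le hx hy
  nlinarith [sq_nonneg (T * (dist p q - dist p r))]

/-- Geodesics from a common origin diverge at least linearly. -/
lemma IsCAT0.dist_le_mul (hX : IsCAT0 X) {p q r x y : X} {l : ℝ} (hl : 0 ≤ l) (hl1 : l ≤ 1)
    (hx : IsPointAt p q (l * dist p q) x) (hy : IsPointAt p r (l * dist p r) y) :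
    dist x y ≤ l * dist q r := by
  have := hX.dist_sq_le hl hl1 hl hl1 hx hy
  apply le_of_sq_le_sq _ (by positivity)
  nlinarith

/-- A convex subset of a CAT(0) space is CAT(0). -/
theorem IsCAT0.subtype (hX : IsCAT0 X) {Y : Set X} (hY : IsGeodesicallyConvex Y) : IsCAT0 Y where
  geodesic x y := by
    obtain ⟨γ, hγ0, hγ1, hγ⟩ := hX.geodesic x y
    have h0 : (0 : ℝ) ≤ dist (x : X) y := dist_nonneg
    have hmem : ∀ t ∈ Set.Icc 0 (dist (x : X) y), γ t ∈ Y := by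
      intro t ht
      apply hY x x.2 y y.2
      conv_lhs => rw [← hγ0, ← hγ1]
      rw [hγ1, hγ 0 ⟨le_rfl, h0⟩ t ht]
      conv_lhs => rw [← hγ1]
      rw [hγ t ht _ ⟨h0, le_rfl⟩, zero_sub, abs_neg, abs_of_nonneg ht.1,
        abs_sub_comm t, abs_of_nonneg (by linarith [ht.2])]
      ring
    refine ⟨fun t => ⟨γ (Set.projIcc 0 _ h0 t), hmem _ (Set.projIcc 0 _ h0 t).2⟩, ?_, ?_, ?_⟩
    · apply Subtype.ext
      simp [hγ0]
    · apply Subtype.ext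
      simp [Subtype.dist_eq, hγ1]
    · intro s hs t ht
      rw [Subtype.dist_eq] at hs ht ⊢
      simp only [Set.projIcc_of_mem h0 hs, Set.projIcc_of_mem h0 ht]
      exact hγ s hs t ht
  comparison p q r x y p' q' r' x' y' := hX.comparison p q r x y p' q' r' x' y'

end CAT0

/-! ### Properness of a space with a geometric action -/

section Proper

variable {G X : Type*} [Group G] [MetricSpace X] [MulAction G X]

/-- A space with a geometric action is uniformly locally compact. -/
lemma IsGeometricAction.exists_isCompact_closedBall (hG : IsGeometricAction G X) :
    ∃ ε > 0, ∀ x : X, IsCompact (Metric.closedBall x ε) := by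
  obtain ⟨K, hK, hcover⟩ := hG.cocompact
  have hdist : ∀ (g : G) (x y : X), dist (g • x) (g • y) = dist x y :=
    fun g x y => (hG.isometry g).dist_eq x y
  choose r hr hfin using hG.proper
  obtain ⟨t, -, ht⟩ := hK.elim_nhds_subcover (fun y => Metric.ball y (r y / 4))
    (fun y _ => Metric.ball_mem_nhds y (by linarith [hr y]))
  obtain ⟨ρ, hρ, hρt⟩ : ∃ ρ > 0, ∀ y ∈ t, ρ ≤ r y / 4 := by
    rcases t.eq_empty_or_nonempty with rfl | hne
    · exact ⟨1, one_pos, by simp⟩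
    · obtain ⟨y, hy, hmin⟩ := t.exists_min_image (fun y => r y / 4) hne
      exact ⟨r y / 4, by linarith [hr y], hmin⟩
  refine ⟨ρ / 2, by linarith, fun x => ?_⟩
  -- If `g₀` and `g` both bring the quarter ball within `ρ` of `x`, then g₀⁻¹g moves `y` by less
  -- than 2(r/4) + 2ρ ≤ r, and only finitely many elements do so.
  have hF : ∀ y ∈ t, {g : G | ∃ z ∈ Metric.ball y (r y / 4), dist (g • z) x < ρ}.Finite := by
    intro y hy
    have hρy := hρt y hy
    rcases Set.eq_empty_or_nonempty {g : G | ∃ z ∈ Metric.ball y (r y / 4), dist (g • z) x < ρ}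
      with h | ⟨g₀, z₀, hz₀, hx₀⟩
    · rw [h]; exact Set.finite_empty
    refine ((hfin y).image (fun g => g₀ * g)).subset ?_
    rintro g ⟨z, hz, hx⟩
    refine ⟨g₀⁻¹ * g, ?_, by simp⟩
    refine ⟨(g₀⁻¹ * g) • y, ⟨y, Metric.mem_ball_self (hr y), rfl⟩, ?_⟩
    rw [Metric.mem_ball] at hz hz₀ ⊢
    have h1 : dist ((g₀⁻¹ * g) • y) y = dist (g • y) (g₀ • y) := by
      rw [← hdist g₀, smul_smul]; simp
    have h2 : dist (g • y) (g • z) = dist z y := by rw [hdist, dist_comm]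
    have h3 : dist (g₀ • z₀) (g₀ • y) = dist z₀ y := hdist _ _ _
    have h4 := dist_triangle4 (g • y) (g • z) x (g₀ • y)
    have h5 := dist_triangle x (g₀ • z₀) (g₀ • y)
    rw [dist_comm x (g₀ • z₀)] at h5
    linarith
  have hfinite : {g : G | ∃ z ∈ K, dist (g • z) x < ρ}.Finite := by
    refine (t.finite_toSet.biUnion hF).subset ?_
    rintro g ⟨z, hz, hx⟩
    obtain ⟨y, hy, hzy⟩ := Set.mem_iUnion₂.1 (ht hz)
    exact Set.mem_iUnion₂.2 ⟨y, hy, z, hzy, hx⟩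
  have hcomp : IsCompact (⋃ g ∈ {g : G | ∃ z ∈ K, dist (g • z) x < ρ}, (fun y : X => g • y) '' K) :=
    hfinite.isCompact_biUnion fun g _ => hK.image (hG.isometry g).continuous
  refine hcomp.of_isClosed_subset Metric.isClosed_closedBall ?_
  intro w hw
  obtain ⟨g, z, hz, rfl⟩ := Set.mem_iUnion.1 (hcover ▸ Set.mem_univ w)
  refine Set.mem_iUnion₂.2 ⟨g, ⟨z, hz, ?_⟩, z, hz, rfl⟩
  rw [Metric.mem_closedBall] at hw
  linarith

/-- A Hopf–Rinow induction: finitely many balls of radius ε/2 cover a compact ball, and along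
geodesics the ball larger by ε/2 lies in the concentric compact balls of radius ε. -/
theorem IsGeometricAction.properSpace (hX : IsCAT0 X) (hG : IsGeometricAction G X) :
    ProperSpace X := by
  obtain ⟨ε, hε, hcomp⟩ := hG.exists_isCompact_closedBall
  have main : ∀ (x : X) (n : ℕ), IsCompact (Metric.closedBall x (n * (ε / 2))) := by
    intro x n
    induction n with
    | zero => simp
    | succ n ih =>
      obtain ⟨t, -, ht⟩ := ih.elim_nhds_subcover (fun y => Metric.ball y (ε / 2))
        (fun y _ => Metric.ball_mem_nhds y (by linarith))
      refine (t.isCompact_biUnion fun y _ => hcomp y).of_isClosed_subset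
        Metric.isClosed_closedBall ?_
      intro w hw
      rw [Metric.mem_closedBall, dist_comm] at hw
      push_cast at hw
      have hn : 0 ≤ n * (ε / 2) := by positivity
      obtain ⟨z, hz1, hz2⟩ := hX.exists_isPointAt (p := x) (q := w)
        (T := min (n * (ε / 2)) (dist x w)) (le_min hn dist_nonneg) (min_le_right _ _)
      have hzn : z ∈ Metric.closedBall x (n * (ε / 2)) := by
        rw [Metric.mem_closedBall, dist_comm, hz1]
        exact min_le_left _ _
      obtain ⟨y, hy, hzy⟩ := Set.mem_iUnion₂.1 (ht hzn)
      refine Set.mem_iUnion₂.2 ⟨y, hy, ?_⟩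
      rw [Metric.mem_ball] at hzy
      rw [Metric.mem_closedBall, dist_comm]
      have hzw : dist z w ≤ ε / 2 := by
        rw [hz2]
        rcases min_cases (n * (ε / 2)) (dist x w) with h | h <;> linarith
      have := dist_triangle y z w
      rw [dist_comm y z] at this
      linarith
  refine ⟨fun x R => ?_⟩
  obtain ⟨n, hn⟩ := exists_nat_gt (R / (ε / 2))
  refine (main x n).of_isClosed_subset Metric.isClosed_closedBall
    (Metric.closedBall_subset_closedBall ?_)
  rw [div_lt_iff₀ (by linarith)] at hn
  exact hn.le

end Proper

/-! ### Rays from a base point and the cone topology -/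

section Rays

variable {Z : Type*} [MetricSpace Z]

lemma GeodesicRay.dist_eq (r : GeodesicRay Z) (s t : ℝ≥0) : dist (r s) (r t) = |(s : ℝ) - t| := by
  rw [r.2.dist_eq, NNReal.dist_eq]

lemma GeodesicRay.dist_zero (r : GeodesicRay Z) (t : ℝ≥0) : dist (r 0) (r t) = t := by
  rw [r.dist_eq, NNReal.coe_zero, zero_sub, abs_neg, NNReal.abs_eq]

lemma GeodesicRay.isPointAt (r : GeodesicRay Z) {s t : ℝ≥0} (h : s ≤ t) :
    IsPointAt (r 0) (r t) s (r s) := by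
  have h' : (s : ℝ) ≤ t := h
  refine ⟨r.dist_zero s, ?_⟩
  rw [r.dist_zero, r.dist_eq, abs_sub_comm, abs_of_nonneg (by linarith)]

lemma GeodesicRay.ext {r r' : GeodesicRay Z} (h : ∀ t, r t = r' t) : r = r' :=
  Subtype.ext (funext h)

lemma GeodesicRay.endpoint_eq_iff {r r' : GeodesicRay Z} :
    r.endpoint = r'.endpoint ↔ Asymptotic r r' :=
  Quotient.eq (r := asymptoticSetoid Z)

lemma exists_endpoint_eq (ξ : Boundary Z) : ∃ r : GeodesicRay Z, r.endpoint = ξ :=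
  Quotient.exists_rep ξ

/-- Geodesics from a common origin converge along ultrafilters in a proper space. -/
lemma exists_geodesicRay_tendsto [ProperSpace Z] {ι : Type*} (𝒰 : Ultrafilter ι) (x : Z)
    (σ : ι → ℝ≥0 → Z) (h : ∀ s t : ℝ≥0, ∀ᶠ k in 𝒰, dist (σ k s) (σ k t) = |(s : ℝ) - t|)
    (h0 : ∀ᶠ k in 𝒰, σ k 0 = x) :
    ∃ ρ : GeodesicRay Z, ρ 0 = x ∧ ∀ t, Tendsto (fun k => σ k t) 𝒰 (𝓝 (ρ t)) := by
  have hlim : ∀ t : ℝ≥0, ∃ z, Tendsto (fun k => σ k t) 𝒰 (𝓝 z) := by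
    intro t
    have hmem : ∀ᶠ k in 𝒰, σ k t ∈ Metric.closedBall x t := by
      filter_upwards [h 0 t, h0] with k hk hk0
      rw [Metric.mem_closedBall, dist_comm, ← hk0, hk, NNReal.coe_zero, zero_sub, abs_neg,
        NNReal.abs_eq]
    obtain ⟨z, -, hz⟩ := (isCompact_closedBall x (t : ℝ)).ultrafilter_le_nhds
      (𝒰.map fun k => σ k t) (le_principal_iff.2 hmem)
    exact ⟨z, hz⟩
  choose ρ hρ using hlim
  refine ⟨⟨ρ, Isometry.of_dist_eq fun s t => ?_⟩, ?_, hρ⟩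
  · refine tendsto_nhds_unique ((hρ s).dist (hρ t)) ?_
    rw [NNReal.dist_eq]
    exact tendsto_const_nhds.congr' ((h s t).mono fun k hk => hk.symm)
  · exact tendsto_nhds_unique (hρ 0) (tendsto_const_nhds.congr' (h0.mono fun k hk => hk.symm))

variable (hZ : IsCAT0 Z)
include hZ

lemma IsCAT0.ray_dist_le {r r' : GeodesicRay Z} (h0 : r 0 = r' 0) {s t : ℝ≥0} (hst : s ≤ t) :
    t * dist (r s) (r' s) ≤ s * dist (r t) (r' t) := by
  have h1 := r.isPointAt hst
  have h2 := r'.isPointAt hst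
  rw [← h0] at h2
  have key := hZ.dist_sq_mul_le' h1 h2
  have e2 : dist (r 0) (r' t) = t := by rw [h0, r'.dist_zero]
  rw [r.dist_zero, e2] at key
  apply le_of_sq_le_sq _ (by positivity)
  nlinarith

lemma IsCAT0.ray_dist_mono {r r' : GeodesicRay Z} (h0 : r 0 = r' 0) {s t : ℝ≥0} (hst : s ≤ t) :
    dist (r s) (r' s) ≤ dist (r t) (r' t) := by
  rcases eq_or_lt_of_le (zero_le (a := t)) with ht | ht
  · have : s = t := le_antisymm hst (ht ▸ zero_le)
    rw [this]
  have key := hZ.ray_dist_le h0 hst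
  have ht' : (0 : ℝ) < t := ht
  have hst' : (s : ℝ) ≤ t := hst
  have := mul_le_mul_of_nonneg_right hst' (dist_nonneg (x := r t) (y := r' t))
  exact le_of_mul_le_mul_left (key.trans this) ht'

/-- Rays with a common origin diverge at least linearly once they differ, so they cannot stay at
bounded distance. -/
lemma IsCAT0.ray_eq_of_asymptotic {r r' : GeodesicRay Z} (h0 : r 0 = r' 0) (h : Asymptotic r r') :
    r = r' := by
  obtain ⟨K, hK⟩ := h
  apply GeodesicRay.ext
  intro s
  by_contra hne
  have hpos : 0 < dist (r s) (r' s) := dist_pos.2 hne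
  obtain ⟨n, hn⟩ := exists_nat_gt (max (s : ℝ) (s * K / dist (r s) (r' s)))
  have h1 : s ≤ (n : ℝ≥0) := by
    have := (le_max_left _ _).trans hn.le
    exact_mod_cast this
  have h2 := (le_max_right _ _).trans_lt hn
  rw [div_lt_iff₀ hpos] at h2
  have h3 := hZ.ray_dist_le h0 h1
  have h4 := mul_le_mul_of_nonneg_left (hK n) s.2
  simp only [NNReal.coe_natCast] at h3
  have h5 : (s : ℝ) * dist (r n) (r' n) ≤ s * K := h4
  linarith

/-- The ray is an ultralimit of the segments from `x` to the points `r n` of some ray to `ξ`. -/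
lemma IsCAT0.exists_ray [ProperSpace Z] (x : Z) (ξ : Boundary Z) :
    ∃ r : GeodesicRay Z, r 0 = x ∧ r.endpoint = ξ := by
  obtain ⟨r, rfl⟩ := exists_endpoint_eq ξ
  set D := dist x (r 0) with hD
  have hgeo := fun n : ℕ => hZ.geodesic x (r n)
  choose γ hγ0 hγ1 hγ using hgeo
  have hdn : ∀ n : ℕ, |dist x (r n) - n| ≤ D := by
    intro n
    have h1 := dist_triangle x (r 0) (r n)
    have h2 := dist_triangle (r 0) x (r n)
    have h3 := r.dist_zero n
    simp only [NNReal.coe_natCast] at h3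
    rw [dist_comm (r 0) x] at h2
    rw [abs_le]
    constructor <;> linarith
  have hlarge : ∀ t : ℝ≥0, ∀ᶠ n : ℕ in (hyperfilter ℕ : Filter ℕ), (t : ℝ) ≤ dist x (r n) := by
    intro t
    apply Nat.hyperfilter_le_atTop
    obtain ⟨N, hN⟩ := exists_nat_gt (t + D)
    filter_upwards [eventually_ge_atTop N] with n hn
    have := (abs_le.1 (hdn n)).1
    have hn' : (N : ℝ) ≤ n := by exact_mod_cast hn
    linarith
  obtain ⟨ρ, hρ0, hρ⟩ := exists_geodesicRay_tendsto (hyperfilter ℕ) x (fun n t => γ n t)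
    (fun s t => by
      filter_upwards [hlarge s, hlarge t] with n hs ht
      exact hγ n s ⟨s.2, hs⟩ t ⟨t.2, ht⟩)
    (Eventually.of_forall fun n => hγ0 n)
  refine ⟨ρ, hρ0, GeodesicRay.endpoint_eq_iff.2 ⟨2 * D, fun t => ?_⟩⟩
  refine le_of_tendsto ((hρ t).dist tendsto_const_nhds) ?_
  have hn1 : ∀ᶠ n : ℕ in (hyperfilter ℕ : Filter ℕ), (t : ℝ) + 1 ≤ n := by
    apply Nat.hyperfilter_le_atTop
    obtain ⟨N, hN⟩ := exists_nat_gt ((t : ℝ) + 1)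
    filter_upwards [eventually_ge_atTop N] with n hn
    have hn' : (N : ℝ) ≤ n := by exact_mod_cast hn
    linarith
  filter_upwards [hlarge t, hn1] with n hn hn1
  have ht0 : (0 : ℝ) ≤ t := t.2
  have hn0 : (0 : ℝ) < n := by linarith
  set d := dist x (r n) with hd
  have hd0 : 0 ≤ d := dist_nonneg
  have hl0 : 0 ≤ 1 - (t : ℝ) / n := by
    rw [sub_nonneg, div_le_one hn0]; linarith
  have hl1 : 1 - (t : ℝ) / n ≤ 1 := by linarith [div_nonneg ht0 hn0.le]
  have htn : (t : ℝ) / n ≤ 1 := by linarith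
  -- Reparametrized proportionally to length, the segment from `x` can be compared with `r` from the
  -- common vertex `r n`, at cost `D`. The reparametrization costs another `D`, since |n - d| ≤ D.
  set t' : ℝ := (t : ℝ) / n * d with ht'
  have ht'0 : 0 ≤ t' := by positivity
  have ht'd : t' ≤ d := mul_le_of_le_one_left hd0 htn
  have e0 := hγ n t' ⟨ht'0, ht'd⟩ d ⟨hd0, le_rfl⟩
  have e1 := hγ n 0 ⟨le_rfl, hd0⟩ t' ⟨ht'0, ht'd⟩
  rw [hγ1] at e0
  rw [hγ0, zero_sub, abs_neg, abs_of_nonneg ht'0] at e1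
  rw [abs_sub_comm, abs_of_nonneg (by linarith)] at e0
  have p1 : IsPointAt (r n) x ((1 - (t : ℝ) / n) * dist (r n) x) (γ n t') := by
    rw [dist_comm (r n) x, ← hd]
    refine ⟨?_, ?_⟩
    · rw [dist_comm, e0, ht']; ring
    · rw [dist_comm, dist_comm _ x, e1, ht', ← hd]; ring
  have hnn : dist (r n) (r 0) = n := by rw [dist_comm, r.dist_zero]; simp
  have p2 : IsPointAt (r n) (r 0) ((1 - (t : ℝ) / n) * dist (r n) (r 0)) (r t) := by
    rw [hnn]
    refine ⟨?_, ?_⟩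
    · rw [r.dist_eq, NNReal.coe_natCast, abs_of_nonneg (by linarith)]; field_simp
    · rw [dist_comm, r.dist_zero, hnn]; field_simp; ring
  have k1 := hZ.dist_le_mul hl0 hl1 p1 p2
  rw [← hD] at k1
  have hD0 : 0 ≤ D := dist_nonneg
  have k1' : dist (γ n t') (r t) ≤ D := k1.trans (mul_le_of_le_one_left hD0 hl1)
  have k2 : dist (γ n t) (γ n t') ≤ D := by
    rw [hγ n t ⟨ht0, hn⟩ t' ⟨ht'0, ht'd⟩]
    have : (t : ℝ) - t' = (t : ℝ) / n * (n - d) := by rw [ht']; field_simp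
    rw [this, abs_mul, abs_of_nonneg (by positivity), abs_sub_comm]
    exact (mul_le_of_le_one_left (abs_nonneg _) htn).trans (hdn n)
  linarith [dist_triangle (γ n t) (γ n t') (r t)]

/-- The ray from `x` to the boundary point `ξ`. -/
noncomputable def IsCAT0.rayTo [ProperSpace Z] (x : Z) (ξ : Boundary Z) : GeodesicRay Z :=
  (hZ.exists_ray x ξ).choose

variable [ProperSpace Z]

lemma IsCAT0.rayTo_zero (x : Z) (ξ : Boundary Z) : hZ.rayTo x ξ 0 = x :=
  (hZ.exists_ray x ξ).choose_spec.1

lemma IsCAT0.endpoint_rayTo (x : Z) (ξ : Boundary Z) : (hZ.rayTo x ξ).endpoint = ξ :=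
  (hZ.exists_ray x ξ).choose_spec.2

lemma IsCAT0.eq_rayTo {x : Z} {ξ : Boundary Z} {r : GeodesicRay Z} (h0 : r 0 = x)
    (h : r.endpoint = ξ) : r = hZ.rayTo x ξ := by
  apply hZ.ray_eq_of_asymptotic
  · rw [h0, hZ.rayTo_zero]
  · rw [← GeodesicRay.endpoint_eq_iff, h, hZ.endpoint_rayTo]

/-- The cone topology is that of pointwise convergence of the rays from `x`; all later topological
arguments go through this description. -/
lemma IsCAT0.isInducing_rayTo (x : Z) :
    IsInducing (fun (ξ : VisualBoundary Z x) (t : ℝ≥0) => hZ.rayTo x ξ t) := by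
  refine ⟨le_antisymm ?_ ?_⟩
  · rw [← continuous_iff_le_induced]
    refine continuous_pi fun t => continuous_iff_continuousAt.2 fun ξ => ?_
    rw [ContinuousAt, Metric.tendsto_nhds]
    intro ε hε
    rcases eq_or_lt_of_le (zero_le (a := t)) with ht | ht
    · subst ht
      have h0 : ∀ η ζ : Boundary Z, dist (hZ.rayTo x η 0) (hZ.rayTo x ζ 0) < ε := fun η ζ => by
        rwa [hZ.rayTo_zero, hZ.rayTo_zero, dist_self]
      exact Eventually.of_forall fun η => h0 η ξ
    have hopen : IsOpen {η : VisualBoundary Z x | ∃ r' : GeodesicRay Z, r'.endpoint = η ∧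
        r' 0 = x ∧ dist (hZ.rayTo x ξ t) (r' t) < ε} :=
      TopologicalSpace.isOpen_generateFrom_of_mem
        ⟨hZ.rayTo x ξ, t, ε, hZ.rayTo_zero x ξ, ht, hε, rfl⟩
    filter_upwards [hopen.mem_nhds ⟨hZ.rayTo x ξ, hZ.endpoint_rayTo x ξ, hZ.rayTo_zero x ξ,
      by simpa using hε⟩] with η hη
    obtain ⟨r', h1, h2, h3⟩ := hη
    rw [dist_comm, ← hZ.eq_rayTo h2 h1]
    exact h3
  · refine le_generateFrom ?_
    rintro U ⟨r, R, ε, h0, hR, hε, rfl⟩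
    refine ⟨{f | dist (r R) (f R) < ε}, ?_, ?_⟩
    · exact isOpen_lt (continuous_const.dist (continuous_apply R)) continuous_const
    · ext η
      constructor
      · intro h
        exact ⟨hZ.rayTo x η, hZ.endpoint_rayTo x η, hZ.rayTo_zero x η, h⟩
      · rintro ⟨r', h1, h2, h3⟩
        have := hZ.eq_rayTo h2 h1
        subst this
        exact h3

lemma IsCAT0.tendsto_visualBoundary_iff {x : Z} {ι : Type*} {l : Filter ι}
    {f : ι → VisualBoundary Z x} {ξ : VisualBoundary Z x} :
    Tendsto f l (𝓝 ξ) ↔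
      ∀ t, Tendsto (fun k => hZ.rayTo x (f k) t) l (𝓝 (hZ.rayTo x ξ t)) := by
  rw [(hZ.isInducing_rayTo x).tendsto_nhds_iff, tendsto_pi_nhds]
  rfl

/-- Sequences of boundary points converge along ultrafilters. -/
lemma IsCAT0.exists_tendsto_rayTo {ι : Type*} (𝒰 : Ultrafilter ι) (x : Z) (f : ι → Boundary Z) :
    ∃ ξ : Boundary Z, ∀ t, Tendsto (fun k => hZ.rayTo x (f k) t) 𝒰 (𝓝 (hZ.rayTo x ξ t)) := by
  obtain ⟨ρ, h0, h⟩ := exists_geodesicRay_tendsto 𝒰 x (fun k t => hZ.rayTo x (f k) t)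
    (fun s t => Eventually.of_forall fun k => GeodesicRay.dist_eq _ _ _)
    (Eventually.of_forall fun k => hZ.rayTo_zero _ _)
  refine ⟨ρ.endpoint, fun t => ?_⟩
  rw [← hZ.eq_rayTo h0 rfl]
  exact h t

theorem IsCAT0.compactSpace_visualBoundary (x : Z) : CompactSpace (VisualBoundary Z x) := by
  refine ⟨isCompact_iff_ultrafilter_le_nhds.2 fun 𝒰 _ => ?_⟩
  obtain ⟨ξ, hξ⟩ := hZ.exists_tendsto_rayTo 𝒰 x id
  exact ⟨ξ, trivial, hZ.tendsto_visualBoundary_iff.2 hξ⟩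

lemma IsCAT0.continuous_rayTo (x : Z) (t : ℝ≥0) :
    Continuous fun ξ : VisualBoundary Z x => hZ.rayTo x ξ t :=
  (continuous_apply t).comp (hZ.isInducing_rayTo x).continuous

lemma IsCAT0.eq_of_rayTo_eq (x : Z) {ξ η : Boundary Z}
    (h : ∀ n : ℕ, hZ.rayTo x ξ n = hZ.rayTo x η n) : ξ = η := by
  rw [← hZ.endpoint_rayTo x ξ, ← hZ.endpoint_rayTo x η]
  congr 1
  apply GeodesicRay.ext
  intro t
  obtain ⟨n, hn⟩ := exists_nat_ge t
  have := hZ.ray_dist_mono (r := hZ.rayTo x ξ) (r' := hZ.rayTo x η)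
    (by rw [hZ.rayTo_zero, hZ.rayTo_zero]) hn
  rw [h n, dist_self] at this
  exact dist_le_zero.1 this

/-- Integer times already determine a ray, and a countable product of copies of `Z` is Hausdorff and
second countable. -/
lemma IsCAT0.continuous_rayTo_nat (x : Z) :
    Continuous fun (ξ : VisualBoundary Z x) (n : ℕ) => hZ.rayTo x ξ n :=
  continuous_pi fun n => hZ.continuous_rayTo x n

lemma IsCAT0.injective_rayTo_nat (x : Z) :
    Function.Injective fun (ξ : VisualBoundary Z x) (n : ℕ) => hZ.rayTo x ξ n :=
  fun _ _ h => hZ.eq_of_rayTo_eq x fun n => congrFun h n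

theorem IsCAT0.t2Space_visualBoundary (x : Z) : T2Space (VisualBoundary Z x) :=
  T2Space.of_injective_continuous (hZ.injective_rayTo_nat x) (hZ.continuous_rayTo_nat x)

theorem IsCAT0.secondCountable_visualBoundary (x : Z) :
    SecondCountableTopology (VisualBoundary Z x) := by
  have := hZ.compactSpace_visualBoundary x
  exact ((hZ.continuous_rayTo_nat x).isClosedEmbedding
    (hZ.injective_rayTo_nat x)).isEmbedding.secondCountableTopology

end Rays

/-! ### Clopen separation forces angle π -/

section Angles

variable {Z : Type*} [MetricSpace Z]

lemma arccos_le_titsAngle {ξ η : Boundary Z} {r r' : GeodesicRay Z} {s t : ℝ≥0}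
    (hr : r.endpoint = ξ) (hr' : r'.endpoint = η) (h0 : r 0 = r' 0) (hs : 0 < s) (ht : 0 < t) :
    Real.arccos (((s : ℝ) ^ 2 + (t : ℝ) ^ 2 - dist (r s) (r' t) ^ 2) / (2 * s * t)) ≤
      titsAngle ξ η := by
  refine le_csSup ⟨Real.pi, ?_⟩ ⟨r, r', s, t, hr, hr', h0, hs, ht, rfl⟩
  rintro a ⟨r, r', s, t, -, -, -, -, -, rfl⟩
  exact Real.arccos_le_pi _

lemma titsAngle_nonneg (ξ η : Boundary Z) : 0 ≤ titsAngle ξ η := by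
  apply Real.sSup_nonneg
  rintro a ⟨r, r', s, t, -, -, -, -, -, rfl⟩
  exact Real.arccos_nonneg _

lemma titsAngle_le_pi (ξ η : Boundary Z) : titsAngle ξ η ≤ Real.pi := by
  refine Real.sSup_le ?_ Real.pi_pos.le
  rintro a ⟨r, r', s, t, -, -, -, -, -, rfl⟩
  exact Real.arccos_le_pi _

lemma eventually_hyperfilter_of_le {p : ℕ → Prop} (N : ℕ) (h : ∀ n, N ≤ n → p n) :
    ∀ᶠ n in (hyperfilter ℕ : Filter ℕ), p n :=
  Nat.hyperfilter_le_atTop (eventually_atTop.2 ⟨N, h⟩)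

variable (hZ : IsCAT0 Z)
include hZ

lemma IsPointAt.unique {p q x y : Z} {T : ℝ} (hx : IsPointAt p q T x)
    (hy : IsPointAt p q T y) : x = y := by
  rcases eq_or_ne p q with rfl | hpq
  · have hT : T = 0 := le_antisymm (by simpa using hx.le) hx.nonneg
    have h1 : p = x := by simpa [hT] using hx.1
    have h2 : p = y := by simpa [hT] using hy.1
    rw [← h1, ← h2]
  have := hZ.dist_sq_mul_le' hx hy
  rw [dist_self, mul_zero] at this
  have hpos : 0 < dist p q := dist_pos.2 hpq
  have h2 : dist x y ^ 2 ≤ 0 := by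
    by_contra! h
    have := mul_pos h (mul_pos hpos hpos)
    linarith
  have h3 : dist x y = 0 := by nlinarith [dist_nonneg (x := x) (y := y)]
  exact dist_eq_zero.1 h3

lemma IsCAT0.titsAngle_self (ξ : Boundary Z) : titsAngle ξ ξ = 0 := by
  apply le_antisymm _ (titsAngle_nonneg _ _)
  refine Real.sSup_le ?_ le_rfl
  rintro a ⟨r, r', s, t, hr, hr', h0, hs, ht, rfl⟩
  have : r = r' := hZ.ray_eq_of_asymptotic h0
    (GeodesicRay.endpoint_eq_iff.1 (hr.trans hr'.symm))
  subst this
  have hs' : (0 : ℝ) < s := hs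
  have ht' : (0 : ℝ) < t := ht
  rw [r.dist_eq, sq_abs]
  have : ((s : ℝ) ^ 2 + (t : ℝ) ^ 2 - ((s : ℝ) - t) ^ 2) / (2 * s * t) = 1 := by
    field_simp
    ring
  rw [this, Real.arccos_one]

variable [ProperSpace Z]

/-- Rays to points at angle `π` diverge almost at full speed. -/
lemma IsCAT0.exists_le_dist_of_titsAngle_eq_pi (x : Z) {ξ η : Boundary Z}
    (h : titsAngle ξ η = Real.pi) {ε : ℝ} (hε : 0 < ε) :
    ∃ T : ℝ≥0, 0 < T ∧ 2 * T * (1 - ε) ≤ dist (hZ.rayTo x ξ T) (hZ.rayTo x η T) := by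
  wlog hε1 : ε ≤ 1 generalizing ε
  · obtain ⟨T, hT, hTd⟩ := this one_pos le_rfl
    refine ⟨T, hT, le_trans ?_ hTd⟩
    have : (0 : ℝ) < T := hT
    push Not at hε1
    nlinarith
  have hlt : Real.arccos (-1 + ε) < titsAngle ξ η := by
    rw [h, ← Real.arccos_neg_one]
    exact Real.strictAntiOn_arccos ⟨le_rfl, by norm_num⟩ ⟨by linarith, by linarith⟩ (by linarith)
  obtain ⟨a, ⟨r, r', s, t, hr, hr', h0, hs, ht, rfl⟩, hlt⟩ := exists_lt_of_lt_csSup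
    (by exact ⟨_, hZ.rayTo x ξ, hZ.rayTo x η, 1, 1, hZ.endpoint_rayTo _ _, hZ.endpoint_rayTo _ _,
      by rw [hZ.rayTo_zero, hZ.rayTo_zero], one_pos, one_pos, rfl⟩) hlt
  have hs' : (0 : ℝ) < s := hs
  have ht' : (0 : ℝ) < t := ht
  have hv := Real.antitone_arccos.reflect_lt hlt
  rw [div_lt_iff₀ (by positivity)] at hv
  -- The near-straight comparison angle occurs at unequal times `s`, `t`; cutting back to the
  -- smaller one costs only a triangle inequality. Linear divergence then carries the bound to large
  -- times, where the change of origin to `x` is absorbed by a second ε.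
  obtain ⟨m, hm, hmd⟩ : ∃ m : ℝ≥0, 0 < m ∧ 2 * m - ε * m ≤ dist (r m) (r' m) := by
    rcases le_total s t with hst | hst
    · have hst' : (s : ℝ) ≤ t := hst
      refine ⟨s, hs, ?_⟩
      have h1 : s + t - ε * s ≤ dist (r s) (r' t) := by
        by_contra! hlt
        have := mul_self_lt_mul_self dist_nonneg hlt
        nlinarith [mul_nonneg (mul_pos (mul_pos hs' hs') hε).le (by linarith : 0 ≤ 2 - ε)]
      have h2 := dist_triangle (r s) (r' s) (r' t)
      rw [r'.dist_eq, abs_sub_comm, abs_of_nonneg (by linarith)] at h2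
      linarith
    · have hst' : (t : ℝ) ≤ s := hst
      refine ⟨t, ht, ?_⟩
      have h1 : s + t - ε * t ≤ dist (r s) (r' t) := by
        by_contra! hlt
        have := mul_self_lt_mul_self dist_nonneg hlt
        nlinarith [mul_nonneg (mul_pos (mul_pos ht' ht') hε).le (by linarith : 0 ≤ 2 - ε)]
      have h2 := dist_triangle (r s) (r t) (r' t)
      rw [r.dist_eq, abs_of_nonneg (by linarith)] at h2
      linarith
  obtain ⟨K, hK⟩ := GeodesicRay.endpoint_eq_iff.1 (hr.trans (hZ.endpoint_rayTo x ξ).symm)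
  obtain ⟨K', hK'⟩ := GeodesicRay.endpoint_eq_iff.1 (hr'.trans (hZ.endpoint_rayTo x η).symm)
  obtain ⟨n, hn⟩ := exists_nat_gt (max (m : ℝ) ((K + K') / ε))
  have hmn := (le_max_left _ _).trans hn.le
  have hKn := (le_max_right _ _).trans_lt hn
  rw [div_lt_iff₀ hε] at hKn
  have hm' : (0 : ℝ) < m := hm
  refine ⟨n, by exact_mod_cast hm'.trans_le hmn, ?_⟩
  have h1 := hZ.ray_dist_le h0 (s := m) (t := n) (by exact_mod_cast hmn)
  have h2 := mul_le_mul_of_nonneg_left hmd (Nat.cast_nonneg n : (0 : ℝ) ≤ n)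
  rw [NNReal.coe_natCast] at h1 ⊢
  have h3 : 2 * n - ε * n ≤ dist (r n) (r' n) := by
    refine le_of_mul_le_mul_left ?_ hm'
    linarith
  have h4 := dist_triangle4 (r n) (hZ.rayTo x ξ n) (hZ.rayTo x η n) (r' n)
  have h5 := hK n
  have h6 := hK' n
  rw [dist_comm] at h6
  have h5' : dist (r n) (hZ.rayTo x ξ n) ≤ K := h5
  have h6' : dist (hZ.rayTo x η n) (r' n) ≤ K' := h6
  linarith

/-- Compactness: otherwise points of `U` and of its complement, ever closer at ever larger times,
have a common limit, which would lie in both closed sets. -/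
lemma IsCAT0.exists_dist_ge_of_isClopen (x : Z) {U : Set (VisualBoundary Z x)} (hU : IsClopen U) :
    ∃ (R : ℝ≥0) (δ : ℝ), 0 < δ ∧ ∀ ρ ρ' : Boundary Z, ρ ∈ U → ρ' ∉ U →
      δ ≤ dist (hZ.rayTo x ρ R) (hZ.rayTo x ρ' R) := by
  by_contra! hcon
  choose ρ ρ' hρ hρ' hd using fun k : ℕ => hcon k (1 / (k + 1)) (by positivity)
  obtain ⟨ξ, hξ⟩ := hZ.exists_tendsto_rayTo (hyperfilter ℕ) x ρ
  obtain ⟨ξ', hξ'⟩ := hZ.exists_tendsto_rayTo (hyperfilter ℕ) x ρ'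
  have h1 : ξ ∈ U := hU.isClosed.mem_of_tendsto (hZ.tendsto_visualBoundary_iff.2 hξ)
    (Eventually.of_forall hρ)
  have h2 : ξ' ∈ Uᶜ := hU.compl.isClosed.mem_of_tendsto (hZ.tendsto_visualBoundary_iff.2 hξ')
    (Eventually.of_forall hρ')
  have h3 : ξ = ξ' := by
    refine hZ.eq_of_rayTo_eq x fun n => ?_
    have hlim := (hξ n).dist (hξ' n)
    have hz : Tendsto (fun k : ℕ => (1 : ℝ) / (k + 1)) (hyperfilter ℕ) (𝓝 0) :=
      tendsto_one_div_add_atTop_nhds_zero_nat.mono_left Nat.hyperfilter_le_atTop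
    apply dist_le_zero.1
    refine le_of_tendsto_of_tendsto hlim hz (eventually_hyperfilter_of_le n fun k hk => ?_)
    exact (hZ.ray_dist_mono (by rw [hZ.rayTo_zero, hZ.rayTo_zero])
      (by exact_mod_cast hk)).trans (hd k).le
  exact h2 (h3 ▸ h1)

omit [ProperSpace Z] hZ in
lemma exists_and_not_succ {p : ℕ → Prop} {N : ℕ} (h0 : p 0) (hN : ¬ p N) :
    ∃ m, p m ∧ ¬ p (m + 1) := by
  by_contra! h
  exact hN (Nat.rec h0 (fun n ih => h n ih) N)

/-- Points of the boundary at angle less than `π` are not separated by a clopen set. -/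
theorem IsCAT0.titsAngle_eq_pi (x : Z) {U : Set (VisualBoundary Z x)} (hU : IsClopen U)
    {ξ η : Boundary Z} (hξ : ξ ∈ U) (hη : η ∉ U) : titsAngle ξ η = Real.pi := by
  by_contra hne
  have hlt := lt_of_le_of_ne (titsAngle_le_pi ξ η) hne
  set α := titsAngle ξ η with hα
  have hα0 : 0 ≤ α := titsAngle_nonneg _ _
  have hcos : -1 < Real.cos α := by
    rw [← Real.cos_pi]
    exact Real.cos_lt_cos_of_nonneg_of_le_pi hα0 le_rfl hlt
  set r := hZ.rayTo x ξ with hr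
  set r' := hZ.rayTo x η with hr'
  have hr0 : r 0 = x := hZ.rayTo_zero _ _
  have hr0' : r' 0 = x := hZ.rayTo_zero _ _
  have hxr : ∀ t : ℝ≥0, dist x (r t) = t := fun t => by rw [← hr0, r.dist_zero]
  have hxr' : ∀ t : ℝ≥0, dist x (r' t) = t := fun t => by rw [← hr0', r'.dist_zero]
  -- The chord 2 sin(α/2) of the angle α in the unit circle. As q < 2, the segment from `r t` to `r'
  -- t` stays at distance at least (1 - q/2)t from `x`.
  set q := √(2 * (1 - Real.cos α)) with hq
  have hq2 : q < 2 := by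
    rw [hq, Real.sqrt_lt' two_pos]; linarith
  have hdq : ∀ t : ℝ≥0, dist (r t) (r' t) ≤ q * t := by
    intro t
    rcases eq_or_lt_of_le (zero_le (a := t)) with ht | ht
    · rw [← ht, hr0, hr0']; simp
    have ht' : (0 : ℝ) < t := ht
    have h1 := arccos_le_titsAngle (hZ.endpoint_rayTo x ξ) (hZ.endpoint_rayTo x η)
      (hr0.trans hr0'.symm) ht ht
    rw [← hr, ← hr', ← hα] at h1
    have h2 := Real.cos_le_cos_of_nonneg_of_le_pi (Real.arccos_nonneg _) hlt.le h1
    have h3 : dist (r t) (r' t) ≤ 2 * t := by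
      have := dist_triangle_left (r t) (r' t) x
      rw [hxr, hxr'] at this
      linarith
    have h4 := dist_nonneg (x := r t) (y := r' t)
    rw [Real.cos_arccos (by rw [le_div_iff₀ (by positivity)]; nlinarith)
      (by rw [div_le_one (by positivity)]; nlinarith), le_div_iff₀ (by positivity)] at h2
    apply le_of_sq_le_sq _ (by positivity)
    rw [mul_pow, hq, Real.sq_sqrt (by linarith [Real.cos_le_one α])]
    linarith
  obtain ⟨R, δ, hδ, hsep⟩ := hZ.exists_dist_ge_of_isClopen x hU
  choose γ hγ0 hγ1 hγ using fun t : ℕ => hZ.geodesic (r t) (r' t)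
  set d : ℕ → ℝ := fun t => dist (r t) (r' t) with hd
  have hd0 : ∀ t, 0 ≤ d t := fun t => dist_nonneg
  -- Steps of length at most 1 along the segment replace a continuity argument by a discrete one;
  -- `min` keeps the parameter in range.
  let z : ℕ → ℕ → Z := fun t m => γ t (min m (d t))
  have hmem : ∀ t m : ℕ, min (m : ℝ) (d t) ∈ Set.Icc 0 (d t) := fun t m =>
    ⟨le_min (Nat.cast_nonneg m) (hd0 t), min_le_right _ _⟩
  have hz : ∀ t m, (1 - q / 2) * t ≤ dist x (z t m) := by
    intro t m
    have h1 := hγ t 0 ⟨le_rfl, hd0 t⟩ _ (hmem t m)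
    have h2 := hγ t _ (hmem t m) (d t) ⟨hd0 t, le_rfl⟩
    rw [hγ0, zero_sub, abs_neg, abs_of_nonneg (hmem t m).1] at h1
    rw [hγ1, abs_sub_comm, abs_of_nonneg (by linarith [(hmem t m).2])] at h2
    have h3 := dist_triangle_right x (r t) (z t m)
    have h4 := dist_triangle x (z t m) (r' t)
    rw [hxr] at h3
    rw [hxr'] at h4
    have h5 := hdq t
    have h6 : d t = dist (r t) (r' t) := rfl
    simp only [NNReal.coe_natCast] at h3 h4 h5
    simp only [z] at h3 h4 ⊢
    linarith
  have hstep : ∀ t m, dist (z t m) (z t (m + 1)) ≤ 1 := by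
    intro t m
    have h1 := hγ t _ (hmem t m) _ (hmem t (m + 1))
    refine h1.le.trans ?_
    refine (abs_min_sub_min_le_max _ _ _ _).trans ?_
    simp
  choose σ hσ0 hσ1 hσ using fun t m : ℕ => hZ.geodesic x (z t m)
  have hσp : ∀ t m (T : ℝ≥0), (T : ℝ) ≤ dist x (z t m) →
      IsPointAt x (z t m) T (σ t m T) := by
    intro t m T hT
    have hD : (0 : ℝ) ≤ dist x (z t m) := dist_nonneg
    have h1 := hσ t m 0 ⟨le_rfl, hD⟩ T ⟨T.2, hT⟩
    have h2 := hσ t m T ⟨T.2, hT⟩ _ ⟨hD, le_rfl⟩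
    rw [hσ0, zero_sub, abs_neg, NNReal.abs_eq] at h1
    rw [hσ1, abs_sub_comm, abs_of_nonneg (by linarith)] at h2
    exact ⟨h1, h2⟩
  have hlarge : ∀ T : ℝ, ∀ᶠ t : ℕ in (hyperfilter ℕ : Filter ℕ), ∀ m, T ≤ dist x (z t m) := by
    intro T
    have hq' : 0 < 1 - q / 2 := by linarith
    obtain ⟨N, hN⟩ := exists_nat_gt (T / (1 - q / 2))
    refine eventually_hyperfilter_of_le N fun t ht m => ?_
    rw [div_lt_iff₀ hq'] at hN
    have ht' : (N : ℝ) ≤ t := by exact_mod_cast ht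
    refine le_trans ?_ (hz t m)
    nlinarith
  -- At radius `R`, the direction of `z t m` seen from `x` is close to `U`. This holds at the end `r
  -- t` and fails at the end `r' t`, so it changes at some step.
  let P : ℕ → ℕ → Prop := fun t m =>
    ∃ ρ : Boundary Z, ρ ∈ U ∧ dist (σ t m R) (hZ.rayTo x ρ R) < δ / 2
  have hP : ∀ᶠ t : ℕ in (hyperfilter ℕ : Filter ℕ), ∃ m, P t m ∧ ¬ P t (m + 1) := by
    obtain ⟨N, hN⟩ := exists_nat_ge R
    refine eventually_hyperfilter_of_le N fun t ht => ?_
    have hRt : R ≤ (t : ℝ≥0) := hN.trans (by exact_mod_cast ht)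
    have hRt' : (R : ℝ) ≤ ((t : ℝ≥0) : ℝ) := hRt
    obtain ⟨M, hM⟩ := exists_nat_ge (d t)
    refine exists_and_not_succ (N := M) ⟨ξ, hξ, ?_⟩ ?_
    · have e : z t 0 = r t := by
        simp only [z, Nat.cast_zero, min_eq_left (hd0 t), hγ0]
      have h1 := hσp t 0 R (by rw [e, hxr]; exact hRt')
      have h2 := r.isPointAt hRt
      rw [hr0] at h2
      rw [e] at h1
      rw [IsPointAt.unique hZ h1 h2, ← hr, dist_self]
      linarith
    · rintro ⟨ρ, hρ, hlt⟩
      have e : z t M = r' t := by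
        simp only [z, min_eq_right hM]; exact hγ1 t
      have h1 := hσp t M R (by rw [e, hxr']; exact hRt')
      have h2 := r'.isPointAt hRt
      rw [hr0'] at h2
      rw [e] at h1
      rw [IsPointAt.unique hZ h1 h2, hr', dist_comm] at hlt
      have := hsep ρ η hρ hη
      linarith
  obtain ⟨m, hm⟩ : ∃ m : ℕ → ℕ, ∀ᶠ t : ℕ in (hyperfilter ℕ : Filter ℕ),
      P t (m t) ∧ ¬ P t (m t + 1) := by
    choose! m hm using fun t (h : ∃ m, P t m ∧ ¬ P t (m + 1)) => h
    exact ⟨m, hP.mono fun t ht => hm t ht⟩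
  have hlim : ∀ m : ℕ → ℕ, ∃ ρ : GeodesicRay Z, ρ 0 = x ∧
      ∀ T : ℝ≥0, Tendsto (fun t => σ t (m t) T) (hyperfilter ℕ) (𝓝 (ρ T)) := by
    intro m
    refine exists_geodesicRay_tendsto (hyperfilter ℕ) x (fun t T => σ t (m t) T) ?_ ?_
    · intro S T
      filter_upwards [hlarge S, hlarge T] with t hS hT
      exact hσ t (m t) S ⟨S.2, hS _⟩ T ⟨T.2, hT _⟩
    · exact Eventually.of_forall fun t => hσ0 t _
  obtain ⟨ρ, hρ0, hρ⟩ := hlim m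
  obtain ⟨ρ', hρ0', hρ'⟩ := hlim fun t => m t + 1
  -- The endpoints on the two sides of the change are at distance at most 1 and recede to infinity,
  -- so the segments from `x` to them have the same limit.
  have heq : ρ' = ρ := by
    symm
    apply GeodesicRay.ext
    intro T
    apply dist_le_zero.1
    refine le_of_forall_pos_le_add fun ε hε => ?_
    refine le_of_tendsto ((hρ T).dist (hρ' T)) ?_
    filter_upwards [hlarge T, hlarge (T / ε), hlarge 1] with t h1 h2 h3
    have k := hZ.dist_sq_mul_le' (hσp t (m t) T (h1 _)) (hσp t (m t + 1) T (h1 _))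
    have k2 : (T * dist (z t (m t)) (z t (m t + 1))) ^ 2 ≤ (T : ℝ) ^ 2 := by
      rw [mul_pow]
      have := hstep t (m t)
      exact mul_le_of_le_one_right (by positivity) (pow_le_one₀ dist_nonneg this)
    have a1 := h2 (m t)
    have a2 := h2 (m t + 1)
    rw [div_le_iff₀ hε] at a1 a2
    have b1 := h3 (m t)
    have b2 := h3 (m t + 1)
    rw [zero_add]
    have hD : 0 < dist x (z t (m t)) * dist x (z t (m t + 1)) := by positivity
    apply le_of_sq_le_sq _ hε.le
    refine le_of_mul_le_mul_right ?_ hD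
    have := mul_le_mul a1 a2 T.2 (by positivity)
    nlinarith
  rw [heq] at hρ'
  have hρe : ρ = hZ.rayTo x ρ.endpoint := hZ.eq_rayTo hρ0 rfl
  have c1 := Metric.tendsto_nhds.1 (hρ R) (δ / 2) (by linarith)
  have c2 := Metric.tendsto_nhds.1 (hρ' R) (δ / 2) (by linarith)
  obtain ⟨t, ⟨⟨μ, hμ, h1⟩, h2⟩, h3, h4⟩ := (hm.and (c1.and c2)).exists
  rw [hρe] at h3 h4
  -- A limit in `U` makes `P` hold after the change; a limit outside `U` is closer than δ to a point
  -- of `U`.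
  by_cases hmemU : (ρ.endpoint : VisualBoundary Z x) ∈ U
  · exact h2 ⟨ρ.endpoint, hmemU, h4⟩
  · have k1 := hsep μ ρ.endpoint hμ hmemU
    have k2 := dist_triangle_left (hZ.rayTo x μ R) (hZ.rayTo x ρ.endpoint R) (σ t (m t) R)
    linarith

end Angles

/-! ### Spherical joins of discrete factors -/

section Join

lemma three_le_card_of_ne {α : Type*} {a b c : α} (hab : a ≠ b) (hbc : b ≠ c) (hac : a ≠ c) :
    3 ≤ ENat.card α := by
  have hinj : Function.Injective ![a, b, c] := by
    intro i j hij
    fin_cases i <;> fin_cases j <;> simp_all [eq_comm]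
  simpa using ENat.card_le_card_of_injective hinj

namespace SphericalJoin

variable {n : ℕ} {A : Fin n → Type*} (ang : ∀ i, A i → A i → ℝ)

open Classical in
/-- The `i`-th contribution to the cosine of the distance in a spherical join. -/
noncomputable def cosTerm (p q : SphericalJoin A) (i : Fin n) : ℝ :=
  if h : p.weight i ≠ 0 ∧ q.weight i ≠ 0 then
    p.weight i * q.weight i * Real.cos (ang i (p.pt i h.1) (q.pt i h.2)) else 0

/-- The cosine of the distance in a spherical join. -/
noncomputable def cosAngle (p q : SphericalJoin A) : ℝ := ∑ i, cosTerm ang p q i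

lemma angle_eq_arccos (p q : SphericalJoin A) : angle ang p q = Real.arccos (cosAngle ang p q) :=
  rfl

lemma cosTerm_of_ne_zero {p q : SphericalJoin A} {i : Fin n} (hp : p.weight i ≠ 0)
    (hq : q.weight i ≠ 0) : cosTerm ang p q i =
      p.weight i * q.weight i * Real.cos (ang i (p.pt i hp) (q.pt i hq)) :=
  dif_pos ⟨hp, hq⟩

lemma cosTerm_of_left_eq_zero {p q : SphericalJoin A} {i : Fin n} (hp : p.weight i = 0) :
    cosTerm ang p q i = 0 :=
  dif_neg fun h => h.1 hp

lemma cosTerm_of_right_eq_zero {p q : SphericalJoin A} {i : Fin n} (hq : q.weight i = 0) :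
    cosTerm ang p q i = 0 :=
  dif_neg fun h => h.2 hq

lemma abs_cosTerm_le (p q : SphericalJoin A) (i : Fin n) :
    |cosTerm ang p q i| ≤ p.weight i * q.weight i := by
  have h0 := mul_nonneg (p.weight_nonneg i) (q.weight_nonneg i)
  by_cases hp : p.weight i = 0
  · simpa [cosTerm_of_left_eq_zero ang hp] using h0
  by_cases hq : q.weight i = 0
  · simpa [cosTerm_of_right_eq_zero ang hq] using h0
  rw [cosTerm_of_ne_zero ang hp hq, abs_mul, abs_of_nonneg h0]
  exact mul_le_of_le_one_right h0 (Real.abs_cos_le_one _)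

lemma abs_cosAngle_le_one (p q : SphericalJoin A) : |cosAngle ang p q| ≤ 1 := by
  have h1 : |cosAngle ang p q| ≤ ∑ i, p.weight i * q.weight i :=
    (Finset.abs_sum_le_sum_abs _ _).trans (Finset.sum_le_sum fun i _ => abs_cosTerm_le ang p q i)
  have h2 : ∑ i, p.weight i * q.weight i ≤ ∑ i, (p.weight i ^ 2 + q.weight i ^ 2) / 2 :=
    Finset.sum_le_sum fun i _ => by nlinarith [sq_nonneg (p.weight i - q.weight i)]
  rw [← Finset.sum_div, Finset.sum_add_distrib, p.sum_sq, q.sum_sq] at h2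
  linarith

lemma cos_angle (p q : SphericalJoin A) : Real.cos (angle ang p q) = cosAngle ang p q := by
  have := abs_le.1 (abs_cosAngle_le_one ang p q)
  rw [angle_eq_arccos, Real.cos_arccos this.1 this.2]

/-- Antipodal points of a spherical join have the same weights and antipodal components. -/
lemma cosTerm_eq_of_cosAngle_eq_neg_one {p q : SphericalJoin A} (h : cosAngle ang p q = -1)
    (i : Fin n) : p.weight i = q.weight i ∧ cosTerm ang p q i = -p.weight i ^ 2 := by
  -- The equality case of Cauchy–Schwarz: each summand dominates a square, so all of them vanish.
  have hsum : ∑ i, (p.weight i ^ 2 + q.weight i ^ 2 + 2 * cosTerm ang p q i) = 0 := by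
    rw [Finset.sum_add_distrib, Finset.sum_add_distrib, p.sum_sq, q.sum_sq, ← Finset.mul_sum]
    change 1 + 1 + 2 * cosAngle ang p q = 0
    rw [h]; norm_num
  have hge : ∀ i, (p.weight i - q.weight i) ^ 2 ≤
      p.weight i ^ 2 + q.weight i ^ 2 + 2 * cosTerm ang p q i := fun i => by
    have := (abs_le.1 (abs_cosTerm_le ang p q i)).1
    nlinarith
  have h0 := (Finset.sum_eq_zero_iff_of_nonneg
    (fun i _ => (sq_nonneg _).trans (hge i))).1 hsum i (Finset.mem_univ i)
  have h1 := hge i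
  rw [h0] at h1
  have h2 : p.weight i = q.weight i := by
    have : (p.weight i - q.weight i) ^ 2 = 0 := le_antisymm h1 (sq_nonneg _)
    exact sub_eq_zero.1 (pow_eq_zero_iff two_ne_zero |>.1 this)
  refine ⟨h2, ?_⟩
  rw [← h2] at h0
  linarith

lemma cos_eq_neg_one_of_cosAngle_eq_neg_one {p q : SphericalJoin A} (h : cosAngle ang p q = -1)
    {i : Fin n} (hp : p.weight i ≠ 0) (hq : q.weight i ≠ 0) :
    Real.cos (ang i (p.pt i hp) (q.pt i hq)) = -1 := by
  obtain ⟨h1, h2⟩ := cosTerm_eq_of_cosAngle_eq_neg_one ang h i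
  rw [cosTerm_of_ne_zero ang hp hq, ← h1] at h2
  have h3 : p.weight i * p.weight i ≠ 0 := mul_ne_zero hp hp
  apply mul_left_cancel₀ h3
  rw [h2]; ring

lemma exists_weight_ne_zero (p : SphericalJoin A) : ∃ i, p.weight i ≠ 0 := by
  by_contra! h
  have := p.sum_sq
  simp [h] at this

/-- In a spherical join, a member of an antipodal triple, whose members are at the same distance
up to sign from every other point, lies in one of the factors. -/
lemma exists_weight_eq_one (hself : ∀ i a, ang i a a = 0) {p p' p'' : SphericalJoin A}
    (h : cosAngle ang p' p = -1) (h' : cosAngle ang p' p'' = -1) (h'' : cosAngle ang p p'' = -1)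
    (habs : ∀ q, |cosAngle ang p q| = |cosAngle ang p' q|) :
    ∃ l, p.weight l = 1 ∧ 3 ≤ ENat.card (A l) := by
  classical
  have hw' : ∀ i, p.weight i = p'.weight i :=
    fun i => (cosTerm_eq_of_cosAngle_eq_neg_one ang h i).1.symm
  have hw'' : ∀ i, p.weight i = p''.weight i :=
    fun i => (cosTerm_eq_of_cosAngle_eq_neg_one ang h'' i).1
  have hne : ∀ (i : Fin n) (a b : A i), Real.cos (ang i a b) = -1 → a ≠ b := by
    rintro i a b hab rfl
    rw [hself, Real.cos_zero] at hab
    norm_num at hab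
  obtain ⟨l, hl⟩ := p.exists_weight_ne_zero
  -- Replacing the `l`-th component of `p''` by that of `p` keeps `q` antipodal to `p'`, but makes
  -- its cosine with `p` equal to w² - (1 - w²), where w is the `l`-th weight. As w ≠ 0, equal
  -- absolute values force w = 1. Two antipodal points would not suffice: in a join of two point
  -- pairs, a circle, any diameter looks alike.
  let q : SphericalJoin A :=
    { weight := p''.weight
      weight_nonneg := p''.weight_nonneg
      sum_sq := p''.sum_sq
      pt := fun m hm => if m = l then p.pt m (by rw [hw'']; exact hm) else p''.pt m hm }
  have hq : ∀ m, p.weight m = q.weight m := hw''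
  have t1 : ∀ m, cosTerm ang p q m =
      (if m = l then 2 * p.weight m ^ 2 else 0) - p.weight m ^ 2 := by
    intro m
    by_cases hm : p.weight m = 0
    · rw [cosTerm_of_left_eq_zero ang hm, hm]; simp
    · have hmq : q.weight m ≠ 0 := hq m ▸ hm
      rw [cosTerm_of_ne_zero ang hm hmq, ← hq m]
      by_cases hml : m = l
      · have e : q.pt m hmq = p.pt m hm := if_pos hml
        rw [e, hself, Real.cos_zero, if_pos hml]; ring
      · have e : q.pt m hmq = p''.pt m hmq := if_neg hml
        rw [e, cos_eq_neg_one_of_cosAngle_eq_neg_one ang h'', if_neg hml]; ring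
  have t2 : ∀ m, cosTerm ang p' q m = - p'.weight m ^ 2 := by
    intro m
    by_cases hm : p'.weight m = 0
    · rw [cosTerm_of_left_eq_zero ang hm, hm]; simp
    · have hmp : p.weight m ≠ 0 := hw' m ▸ hm
      have hmq : q.weight m ≠ 0 := hq m ▸ hmp
      rw [cosTerm_of_ne_zero ang hm hmq, ← hq m, hw' m]
      by_cases hml : m = l
      · have e : q.pt m hmq = p.pt m hmp := if_pos hml
        rw [e, cos_eq_neg_one_of_cosAngle_eq_neg_one ang h]; ring
      · have e : q.pt m hmq = p''.pt m hmq := if_neg hml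
        rw [e, cos_eq_neg_one_of_cosAngle_eq_neg_one ang h']; ring
  have s1 : cosAngle ang p q = 2 * p.weight l ^ 2 - 1 := by
    rw [cosAngle, Finset.sum_congr rfl fun m _ => t1 m, Finset.sum_sub_distrib, p.sum_sq]
    simp
  have s2 : cosAngle ang p' q = -1 := by
    rw [cosAngle, Finset.sum_congr rfl fun m _ => t2 m, Finset.sum_neg_distrib, p'.sum_sq]
  have hwl : p.weight l = 1 := by
    have h3 := habs q
    rw [s1, s2, abs_neg, abs_one] at h3
    have hpos : 0 < p.weight l := lt_of_le_of_ne (p.weight_nonneg l) hl.symm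
    rcases (abs_eq one_pos.le).1 h3 with h4 | h4 <;> nlinarith
  have hl' : p'.weight l ≠ 0 := hw' l ▸ hl
  have hl'' : p''.weight l ≠ 0 := hw'' l ▸ hl
  exact ⟨l, hwl, three_le_card_of_ne
    (hne l _ _ (cos_eq_neg_one_of_cosAngle_eq_neg_one ang h hl' hl)).symm
    (hne l _ _ (cos_eq_neg_one_of_cosAngle_eq_neg_one ang h' hl' hl''))
    (hne l _ _ (cos_eq_neg_one_of_cosAngle_eq_neg_one ang h'' hl hl''))⟩

lemma weight_eq_zero_of_weight_eq_one {p : SphericalJoin A} {i j : Fin n} (h : p.weight i = 1)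
    (hij : j ≠ i) : p.weight j = 0 := by
  have h1 := p.sum_sq
  rw [← Finset.add_sum_erase _ _ (Finset.mem_univ i), h] at h1
  have h2 : ∑ k ∈ Finset.univ.erase i, p.weight k ^ 2 = 0 := by linarith
  have h3 := (Finset.sum_eq_zero_iff_of_nonneg fun k _ => sq_nonneg (p.weight k)).1 h2 j (by simp [hij])
  exact pow_eq_zero_iff two_ne_zero |>.1 h3

lemma cosAngle_eq_cosTerm {p q : SphericalJoin A} {i : Fin n} (h : p.weight i = 1) :
    cosAngle ang p q = cosTerm ang p q i :=
  Finset.sum_eq_single i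
    (fun _ _ hj => cosTerm_of_left_eq_zero ang (weight_eq_zero_of_weight_eq_one h hj)) (by simp)

/-- A point of a factor, as a point of the join. -/
noncomputable def single (i : Fin n) (a : A i) : SphericalJoin A where
  weight := Pi.single i 1
  weight_nonneg j := by
    rcases eq_or_ne j i with rfl | h
    · simp
    · simp [h]
  sum_sq := by
    rw [Finset.sum_eq_single i (fun j _ hj => by simp [hj]) (by simp)]
    simp
  pt j h := (show i = j by
    by_contra hne
    exact h (Pi.single_eq_of_ne (Ne.symm hne) _)) ▸ a

lemma single_weight (i : Fin n) (a : A i) : (single i a).weight i = 1 := Pi.single_eq_same i 1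

lemma single_pt (i : Fin n) (a : A i) (h : (single i a).weight i ≠ 0) : (single i a).pt i h = a :=
  rfl

lemma cosAngle_single_single (i : Fin n) (a b : A i) :
    cosAngle ang (single i a) (single i b) = Real.cos (ang i a b) := by
  have h : ∀ c : A i, (single i c).weight i ≠ 0 := fun c => by
    rw [single_weight]; exact one_ne_zero
  rw [cosAngle_eq_cosTerm ang (single_weight i a), cosTerm_of_ne_zero ang (h a) (h b),
    single_weight, single_weight, single_pt, single_pt]
  ring

lemma cosAngle_single_single_of_ne {i j : Fin n} (hij : i ≠ j) (a : A i) (b : A j) :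
    cosAngle ang (single i a) (single j b) = 0 := by
  rw [cosAngle_eq_cosTerm ang (single_weight i a)]
  exact cosTerm_of_right_eq_zero ang (weight_eq_zero_of_weight_eq_one (single_weight j b) hij)

/-- With angles 0 and π only, all points of a factor see a given `q` at the same angle up to sign.
This is the property by which factors are recognized. -/
lemma abs_cosAngle_single (hcos : ∀ i a b, |Real.cos (ang i a b)| = 1) (i : Fin n) (a : A i)
    (q : SphericalJoin A) : |cosAngle ang (single i a) q| = q.weight i := by
  rw [cosAngle_eq_cosTerm ang (single_weight i a)]
  by_cases hq : q.weight i = 0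
  · rw [cosTerm_of_right_eq_zero ang hq, hq, abs_zero]
  · rw [cosTerm_of_ne_zero ang (by rw [single_weight]; exact one_ne_zero) hq, abs_mul, hcos, mul_one,
      single_weight, one_mul, abs_of_nonneg (q.weight_nonneg i)]

end SphericalJoin

/-- The angular structure of a boundary which is a join of discrete factors. -/
structure IsJoinOfDiscrete {X : Type*} [MetricSpace X] {n : ℕ} (Y : Fin n → Set X) : Prop where
  isJoin : BoundaryIsJoin Y
  titsAngle_self : ∀ i (ξ : Boundary (Y i)), titsAngle ξ ξ = 0
  titsAngle_of_ne : ∀ i (ξ η : Boundary (Y i)), ξ ≠ η → titsAngle ξ η = Real.pi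

namespace IsJoinOfDiscrete

variable {X : Type*} [MetricSpace X] {n : ℕ} {Y : Fin n → Set X} (h : IsJoinOfDiscrete Y)
include h

lemma cos_titsAngle_of_ne {i : Fin n} {ξ η : Boundary (Y i)} (hne : ξ ≠ η) :
    Real.cos (titsAngle ξ η) = -1 := by
  rw [h.titsAngle_of_ne i ξ η hne, Real.cos_pi]

lemma abs_cos_titsAngle (i : Fin n) (ξ η : Boundary (Y i)) : |Real.cos (titsAngle ξ η)| = 1 := by
  rcases eq_or_ne ξ η with rfl | hne
  · rw [h.titsAngle_self, Real.cos_zero, abs_one]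
  · rw [h.cos_titsAngle_of_ne hne, abs_neg, abs_one]

lemma exists_equiv : ∃ Φ : SphericalJoin (fun i => Boundary (Y i)) ≃ Boundary X,
    (∀ p q, Real.cos (titsAngle (Φ p) (Φ q)) =
      SphericalJoin.cosAngle (fun _ => titsAngle) p q) ∧
    (∀ i (ζ : Boundary (Y i)),
      Φ (SphericalJoin.single (A := fun i => Boundary (Y i)) i ζ) = boundaryIncl (Y i) ζ) ∧
    ∀ p i, p.weight i = 1 → ∃ ζ : Boundary (Y i), Φ p = boundaryIncl (Y i) ζ := by
  obtain ⟨Φ, hΦ, hincl⟩ := h.isJoin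
  exact ⟨Φ, fun p q => by rw [hΦ, SphericalJoin.cos_angle],
    fun i ζ => hincl _ i (SphericalJoin.single_weight (A := fun i => Boundary (Y i)) i ζ),
    fun p i hp => ⟨_, hincl p i hp⟩⟩

lemma cos_titsAngle_boundaryIncl (i : Fin n) (ξ η : Boundary (Y i)) :
    Real.cos (titsAngle (boundaryIncl (Y i) ξ) (boundaryIncl (Y i) η)) =
      Real.cos (titsAngle ξ η) := by
  obtain ⟨Φ, hΦ, e, -⟩ := h.exists_equiv
  rw [← e, ← e, hΦ, SphericalJoin.cosAngle_single_single]

lemma titsAngle_boundaryIncl_of_ne {i : Fin n} {ξ η : Boundary (Y i)} (hne : ξ ≠ η) :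
    titsAngle (boundaryIncl (Y i) ξ) (boundaryIncl (Y i) η) = Real.pi := by
  have h1 := h.cos_titsAngle_boundaryIncl i ξ η
  rw [h.cos_titsAngle_of_ne hne, ← Real.cos_pi] at h1
  exact Real.injOn_cos ⟨titsAngle_nonneg _ _, titsAngle_le_pi _ _⟩ ⟨Real.pi_pos.le, le_rfl⟩ h1

lemma eq_of_cos_titsAngle_ne_zero {i j : Fin n} {ξ : Boundary (Y i)} {η : Boundary (Y j)}
    (hcos : Real.cos (titsAngle (boundaryIncl (Y i) ξ) (boundaryIncl (Y j) η)) ≠ 0) : i = j := by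
  obtain ⟨Φ, hΦ, e, -⟩ := h.exists_equiv
  by_contra hij
  apply hcos
  rw [← e, ← e, hΦ, SphericalJoin.cosAngle_single_single_of_ne _ hij]

/-- Angle-preserving bijections of the boundary permute the factors with at least three points. -/
theorem exists_apply_boundaryIncl_eq (T : Boundary X ≃ Boundary X)
    (hT : ∀ ξ η, titsAngle (T ξ) (T η) = titsAngle ξ η) {i : Fin n}
    (hi : 3 ≤ ENat.card (Boundary (Y i))) (ξ : Boundary (Y i)) :
    ∃ j, (∃ η : Boundary (Y j), T (boundaryIncl (Y i) ξ) = boundaryIncl (Y j) η) ∧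
      3 ≤ ENat.card (Boundary (Y j)) := by
  obtain ⟨Φ, hΦ, e, hincl⟩ := h.exists_equiv
  obtain ⟨ξ', hξ', -⟩ := ENat.exists_ne_ne_of_three_le hi ξ ξ
  obtain ⟨ξ'', h1, h2⟩ := ENat.exists_ne_ne_of_three_le hi ξ ξ'
  have hanti : ∀ ζ ζ' : Boundary (Y i), ζ ≠ ζ' → SphericalJoin.cosAngle (fun _ => titsAngle)
      (Φ.symm (T (boundaryIncl (Y i) ζ))) (Φ.symm (T (boundaryIncl (Y i) ζ'))) = -1 := by
    intro ζ ζ' hne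
    rw [← hΦ, Φ.apply_symm_apply, Φ.apply_symm_apply, hT, h.cos_titsAngle_boundaryIncl,
      h.cos_titsAngle_of_ne hne]
  -- The right side does not involve `ζ`: this is the hypothesis `habs` of
  -- `SphericalJoin.exists_weight_eq_one` for the image of the factor.
  have habs : ∀ (ζ : Boundary (Y i)) q, |SphericalJoin.cosAngle (fun _ => titsAngle)
      (Φ.symm (T (boundaryIncl (Y i) ζ))) q| = (Φ.symm (T.symm (Φ q))).weight i := by
    intro ζ q
    rw [← hΦ, Φ.apply_symm_apply, ← SphericalJoin.abs_cosAngle_single (fun _ => titsAngle)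
      h.abs_cos_titsAngle i ζ, ← hΦ, e, Φ.apply_symm_apply,
      ← hT _ (T.symm (Φ q)), T.apply_symm_apply]
  obtain ⟨l, hl, hthree⟩ := SphericalJoin.exists_weight_eq_one (fun _ => titsAngle)
    (fun i a => h.titsAngle_self i a) (hanti ξ' ξ hξ') (hanti ξ' ξ'' h2.symm)
    (hanti ξ ξ'' h1.symm) (fun q => by rw [habs, habs])
  obtain ⟨η, hη⟩ := hincl _ l hl
  exact ⟨l, ⟨η, by rw [← hη, Φ.apply_symm_apply]⟩, hthree⟩

end IsJoinOfDiscrete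

end Join

/-! ### The action on the boundary and π-convergence -/

section Dynamics

/-- The image of a ray under an isometric embedding. -/
def GeodesicRay.map {X Z : Type*} [MetricSpace X] [MetricSpace Z] {f : Z → X} (hf : Isometry f)
    (r : GeodesicRay Z) : GeodesicRay X :=
  ⟨f ∘ r.1, hf.comp r.2⟩

lemma GeodesicRay.map_apply {X Z : Type*} [MetricSpace X] [MetricSpace Z] {f : Z → X}
    (hf : Isometry f) (r : GeodesicRay Z) (t : ℝ≥0) : r.map hf t = f (r t) := rfl

lemma boundaryIncl_endpoint {X : Type*} [MetricSpace X] (Y : Set X) (r : GeodesicRay Y) :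
    boundaryIncl Y r.endpoint = (r.map isometry_subtype_coe).endpoint := rfl

section Cone

variable {X : Type*} [MetricSpace X]

/-- Long segments from `a` whose far ends stay within `K` are nearly equal close to `a`, with error
at most SK/M when M > 0. -/
lemma IsCAT0.dist_mul_le (hX : IsCAT0 X) {a p q u v : X} {S K M : ℝ} (hM : 0 ≤ M)
    (hu : IsPointAt a p S u) (hv : IsPointAt a q S v) (hK : dist p q ≤ K) (hp : M ≤ dist a p)
    (hq : M ≤ dist a q) : dist u v * M ≤ S * K := by
  have hS := hu.nonneg
  have hK0 : 0 ≤ K := dist_nonneg.trans hK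
  have h1 := hX.dist_sq_mul_le' hu hv
  have h2 : (S * dist p q) ^ 2 ≤ (S * K) ^ 2 :=
    pow_le_pow_left₀ (by positivity) (mul_le_mul_of_nonneg_left hK hS) 2
  have h3 := mul_le_mul_of_nonneg_left (mul_le_mul hp hq hM (hM.trans hp)) (sq_nonneg (dist u v))
  apply le_of_sq_le_sq _ (by positivity)
  calc (dist u v * M) ^ 2 = dist u v ^ 2 * (M * M) := by ring
    _ ≤ _ := h3.trans (h1.trans h2)

/-- If a ray `ρ` from `x` and the segment from `x` to `a` diverge almost at full speed, then the
ray from `a` asymptotic to `ρ` follows closely the segment from `a` to `x`. -/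
theorem IsCAT0.dist_le_of_diverge (hX : IsCAT0 X) {x a w u : X} {ρ c : GeodesicRay X}
    (hρ : ρ 0 = x) (hc : c 0 = a) (hasym : Asymptotic c ρ) {T S : ℝ≥0} (hT : 0 < T)
    (hw : IsPointAt x a T w) (hu : IsPointAt a x S u) {κ : ℝ} (hκ0 : 0 ≤ κ) (hκ1 : κ ≤ 1)
    (h : 2 * T * (1 - κ ^ 2) ≤ dist w (ρ T)) : dist u (c S) ≤ 4 * S * κ := by
  refine le_of_forall_pos_le_add fun δ hδ => ?_
  obtain ⟨K, hK⟩ := hasym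
  have hK0 : 0 ≤ K := dist_nonneg.trans (hK 0)
  have hT' : (0 : ℝ) < T := hT
  have hS0 : (0 : ℝ) ≤ S := S.2
  have hD : 0 < dist x a := hT'.trans_le hw.le
  obtain ⟨L, hL⟩ := exists_nat_gt (dist x a + (T + S + S * K / δ + 1))
  have hSK : 0 ≤ S * K / δ := by positivity
  have hTL : T ≤ (L : ℝ≥0) := by
    have : (T : ℝ) ≤ L := by linarith
    exact_mod_cast this
  have hSL : S ≤ (L : ℝ≥0) := by
    have : (S : ℝ) ≤ L := by linarith
    exact_mod_cast this
  have hxb : dist x (ρ L) = L := by rw [← hρ, ρ.dist_zero]; simp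
  have hac : dist a (c L) = L := by rw [← hc, c.dist_zero]; simp
  have hρT := ρ.isPointAt hTL
  have hcS := c.isPointAt hSL
  rw [hρ] at hρT
  rw [hc] at hcS
  have e1 : (L : ℝ) - dist x a ≤ dist a (ρ L) := by
    have := dist_triangle x a (ρ L)
    linarith
  have e2 : dist a (ρ L) ≤ L + dist x a := by
    have := dist_triangle_left a (ρ L) x
    linarith
  obtain ⟨v, hv⟩ := hX.exists_isPointAt (p := a) (q := ρ L) (T := S) hS0 (by linarith)
  have k1 := hX.dist_sq_mul_le hw hρT
  have k2 := hX.dist_sq_mul_le hu hv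
  rw [hxb] at k1 k2
  rw [dist_comm a x] at k2
  set D := dist x a with hDdef
  set e := dist a (ρ L) with he
  have hL0 : (0 : ℝ) < L := by linarith
  have he0 : 0 < e := by linarith
  have hvc : dist v (c S) ≤ δ := by
    have := hX.dist_mul_le (K := K) (M := S * K / δ + 1) (by positivity) hv hcS
      (by rw [dist_comm]; exact hK L) (by linarith) (by linarith)
    have h3 : (S : ℝ) * K ≤ δ * (S * K / δ + 1) := by
      rw [mul_add, mul_div_cancel₀ _ hδ.ne']; linarith
    exact le_of_mul_le_mul_right (this.trans h3) (by positivity)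
  have hκ2 : 0 ≤ 1 - κ ^ 2 := by nlinarith
  have k4 : (2 * T * (1 - κ ^ 2)) ^ 2 ≤ dist w (ρ T) ^ 2 :=
    pow_le_pow_left₀ (by positivity) h 2
  -- Comparison at `x` in the triangle `x`, `a`, `ρ L`: the angle there is nearly π, so the excess L
  -- + D - e is small (`k6`). Comparison at `a` turns this into a small angle at `a` (`k7`), and 4κ
  -- is the root of 16κ².
  have k5 : 4 * (1 - κ ^ 2) ^ 2 * (D * L) ≤ e ^ 2 - (D - L) ^ 2 := by
    have := mul_le_mul_of_nonneg_right k4 (mul_pos hD hL0).le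
    refine le_of_mul_le_mul_left ?_ (by positivity : (0 : ℝ) < T ^ 2)
    linarith
  have k6 : L + D - e ≤ 8 * D * κ ^ 2 := by
    refine le_of_mul_le_mul_right ?_ hL0
    have h1 : 0 ≤ (L + D - e) * (D + e) := mul_nonneg (by linarith) (by linarith)
    have h2 : 0 ≤ D * L * (κ ^ 2) ^ 2 := by positivity
    linarith
  have k7 : (L : ℝ) ^ 2 - (D - e) ^ 2 ≤ 16 * κ ^ 2 * (D * e) := by
    have h1 : (L - D + e) * (L + D - e) ≤ (2 * e) * (8 * D * κ ^ 2) :=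
      mul_le_mul (by linarith) k6 (by linarith) (by linarith)
    linarith
  have k8 : dist u v ≤ 4 * S * κ := by
    apply le_of_sq_le_sq _ (by positivity)
    refine le_of_mul_le_mul_right ?_ (mul_pos hD he0)
    have := mul_le_mul_of_nonneg_left k7 (sq_nonneg (S : ℝ))
    linarith
  linarith [dist_triangle u v (c S)]

end Cone

variable {G X : Type*} [Group G] [MetricSpace X] [MulAction G X]

/-- The map of the boundary induced by an isometry. -/
def boundaryMap {f : X → X} (hf : Isometry f) : Boundary X → Boundary X :=
  Quotient.map (sa := asymptoticSetoid X) (sb := asymptoticSetoid X) (GeodesicRay.map hf)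
    (fun _ _ ⟨K, hK⟩ => ⟨K, fun t => (hf.dist_eq _ _).le.trans (hK t)⟩)

lemma boundaryMap_endpoint {f : X → X} (hf : Isometry f) (r : GeodesicRay X) :
    boundaryMap hf r.endpoint = (r.map hf).endpoint := rfl

/-- Pairs of rays are carried to congruent pairs. As `f` need not be onto, this gives one
inequality; for group elements the inverse gives the other. -/
lemma titsAngle_le_boundaryMap {f : X → X} (hf : Isometry f) (ξ η : Boundary X) :
    titsAngle ξ η ≤ titsAngle (boundaryMap hf ξ) (boundaryMap hf η) := by
  refine Real.sSup_le ?_ (titsAngle_nonneg _ _)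
  rintro a ⟨r, r', s, t, rfl, rfl, h0, hs, ht, rfl⟩
  have := arccos_le_titsAngle (boundaryMap_endpoint hf r).symm (boundaryMap_endpoint hf r').symm
    (by rw [GeodesicRay.map_apply, GeodesicRay.map_apply, h0]) hs ht
  rwa [GeodesicRay.map_apply, GeodesicRay.map_apply, hf.dist_eq] at this

lemma boundaryMap_smul_smul (hG : IsGeometricAction G X) {g h : G} (hgh : g * h = 1)
    (ξ : Boundary X) : boundaryMap (hG.isometry g) (boundaryMap (hG.isometry h) ξ) = ξ := by
  obtain ⟨r, rfl⟩ := exists_endpoint_eq ξ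
  rw [boundaryMap_endpoint, boundaryMap_endpoint]
  congr 1
  apply GeodesicRay.ext
  intro t
  simp only [GeodesicRay.map_apply, smul_smul, hgh, one_smul]

/-- The action of a group element on the boundary. -/
def IsGeometricAction.boundaryEquiv (hG : IsGeometricAction G X) (g : G) :
    Boundary X ≃ Boundary X where
  toFun := boundaryMap (hG.isometry g)
  invFun := boundaryMap (hG.isometry g⁻¹)
  left_inv := boundaryMap_smul_smul hG (inv_mul_cancel g)
  right_inv := boundaryMap_smul_smul hG (mul_inv_cancel g)

lemma IsGeometricAction.boundaryEquiv_inv_apply (hG : IsGeometricAction G X) (g : G)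
    (ξ : Boundary X) : hG.boundaryEquiv g (hG.boundaryEquiv g⁻¹ ξ) = ξ :=
  boundaryMap_smul_smul hG (mul_inv_cancel g) ξ

lemma IsGeometricAction.titsAngle_boundaryEquiv (hG : IsGeometricAction G X) (g : G)
    (ξ η : Boundary X) :
    titsAngle (hG.boundaryEquiv g ξ) (hG.boundaryEquiv g η) = titsAngle ξ η := by
  apply le_antisymm _ (titsAngle_le_boundaryMap _ _ _)
  have := titsAngle_le_boundaryMap (hG.isometry g⁻¹) (hG.boundaryEquiv g ξ) (hG.boundaryEquiv g η)
  have e := (hG.boundaryEquiv g).left_inv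
  change ∀ ξ, boundaryMap (hG.isometry g⁻¹) (hG.boundaryEquiv g ξ) = ξ at e
  rwa [e, e] at this

lemma IsGeometricAction.exists_dist_smul_le (hG : IsGeometricAction G X) (x : X) :
    ∃ C : ℝ, ∀ p : X, ∃ g : G, dist (g • x) p ≤ C := by
  obtain ⟨K, hK, hcover⟩ := hG.cocompact
  obtain ⟨C, hC⟩ := Metric.isBounded_iff.1 hK.isBounded
  obtain ⟨g₁, k₁, hk₁, e₁⟩ := Set.mem_iUnion.1 (hcover ▸ Set.mem_univ x)
  refine ⟨C, fun p => ?_⟩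
  obtain ⟨g, k, hk, e⟩ := Set.mem_iUnion.1 (hcover ▸ Set.mem_univ p)
  refine ⟨g * g₁⁻¹, ?_⟩
  simp only at e e₁
  rw [← e, ← e₁, smul_smul, inv_mul_cancel_right, (hG.isometry g).dist_eq]
  exact hC hk₁ hk

/-- If `g k • x` converges to `σ(∞)` and `g k • c(∞)` converges to a point at angle `π` from
`σ(∞)`, then `(g k)⁻¹ • x` converges to `c(∞)`. -/
theorem IsCAT0.eventually_dist_le_of_titsAngle_eq_pi [ProperSpace X] (hX : IsCAT0 X)
    (hG : IsGeometricAction G X) {ι : Type*} {l : Filter ι} {g : ι → G} {x : X}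
    {σ ρ c : GeodesicRay X} {ρ' : ι → GeodesicRay X} (hσ0 : σ 0 = x) (hρ0 : ρ 0 = x)
    (hc0 : c 0 = x) (hρ'0 : ∀ k, ρ' k 0 = x)
    (hσ : ∀ (T : ℝ≥0) (ε : ℝ), 0 < ε → ∀ᶠ k in l,
      ∃ w, IsPointAt x (g k • x) T w ∧ dist w (σ T) ≤ ε)
    (hρ : ∀ T, Tendsto (fun k => ρ' k T) l (𝓝 (ρ T)))
    (hc : ∀ᶠ k in l, hG.boundaryEquiv (g k) c.endpoint = (ρ' k).endpoint)
    (hπ : titsAngle ρ.endpoint σ.endpoint = Real.pi) (S : ℝ≥0) {κ : ℝ} (hκ0 : 0 < κ)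
    (hκ1 : κ ≤ 1) :
    ∀ᶠ k in l, ∀ u, IsPointAt x ((g k)⁻¹ • x) S u → dist u (c S) ≤ 4 * S * κ := by
  -- Half of the allowed loss 2Tκ² is spent here; the other half covers the two approximations of `σ
  -- T` and `ρ T`, of Tκ²/2 each.
  obtain ⟨T, hT, hTd⟩ := hX.exists_le_dist_of_titsAngle_eq_pi x hπ
    (show 0 < κ ^ 2 / 2 by positivity)
  rw [← hX.eq_rayTo hρ0 rfl, ← hX.eq_rayTo hσ0 rfl] at hTd
  have hT' : (0 : ℝ) < T := hT
  have hε : 0 < T * κ ^ 2 / 2 := by positivity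
  filter_upwards [hσ T _ hε, Metric.tendsto_nhds.1 (hρ T) _ hε, hc] with k h1 h2 h3 u hu
  obtain ⟨w, hw, hwσ⟩ := h1
  have hu' : IsPointAt (g k • x) x S (g k • u) := by
    have e : ∀ p q : X, dist (g k • p) (g k • q) = dist p q := (hG.isometry (g k)).dist_eq
    refine ⟨by rw [e, hu.1], ?_⟩
    have h4 := e u ((g k)⁻¹ • x)
    have h5 := e x ((g k)⁻¹ • x)
    rw [smul_inv_smul] at h4 h5
    rw [h4, h5, hu.2]
  have key := hX.dist_le_of_diverge (c := c.map (hG.isometry (g k))) (hρ'0 k)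
    (by rw [GeodesicRay.map_apply, hc0]) (GeodesicRay.endpoint_eq_iff.1 h3) hT hw hu' hκ0.le hκ1
    (by
      have := dist_triangle4 (ρ T) (ρ' k T) w (σ T)
      rw [dist_comm (ρ T) (ρ' k T), dist_comm (ρ' k T) w] at this
      linarith)
  rwa [GeodesicRay.map_apply, (hG.isometry (g k)).dist_eq] at key

end Dynamics

/-! ### No isolated points -/

section Perfect

variable {G X : Type*} [Group G] [MetricSpace X] [MulAction G X]

/-- The translates of `x` that follow a ray `σ` converge to its endpoint. -/
lemma IsCAT0.eventually_isPointAt_smul (hX : IsCAT0 X) {x : X} {σ : GeodesicRay X}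
    (hσ0 : σ 0 = x) {a : ℕ → X} {C : ℝ} (ha : ∀ k : ℕ, dist (a k) (σ k) ≤ C) (T : ℝ≥0) {ε : ℝ}
    (hε : 0 < ε) : ∀ᶠ k in (hyperfilter ℕ : Filter ℕ),
      ∃ w, IsPointAt x (a k) T w ∧ dist w (σ T) ≤ ε := by
  have hC : 0 ≤ C := dist_nonneg.trans (ha 0)
  have hT : (0 : ℝ) ≤ T := T.2
  have hM : 0 ≤ T * C / ε := by positivity
  obtain ⟨N, hN⟩ := exists_nat_gt (C + T + T * C / ε + 1)
  refine eventually_hyperfilter_of_le N fun k hk => ?_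
  have hk' : (N : ℝ) ≤ k := by exact_mod_cast hk
  have hTk : T ≤ (k : ℝ≥0) := by
    have : (T : ℝ) ≤ k := by linarith
    exact_mod_cast this
  have hxσ : dist x (σ k) = k := by rw [← hσ0, σ.dist_zero]; simp
  have h1 := dist_triangle x (a k) (σ k)
  have h2 := ha k
  obtain ⟨w, hw⟩ := hX.exists_isPointAt (p := x) (q := a k) (T := T) hT (by linarith)
  refine ⟨w, hw, ?_⟩
  have hσT := σ.isPointAt hTk
  rw [hσ0] at hσT
  have h3 := hX.dist_mul_le (M := T * C / ε + 1) (by positivity) hw hσT h2 (by linarith)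
    (by linarith)
  have h4 : (T : ℝ) * C ≤ ε * (T * C / ε + 1) := by
    rw [mul_add, mul_div_cancel₀ _ hε.ne']; linarith
  exact le_of_mul_le_mul_right (h3.trans h4) (by positivity)

lemma IsCAT0.boundaryIncl_eq {Y : Set X} [ProperSpace Y]
    (hY : IsCAT0 Y) (x : Y) (ξ : Boundary Y) :
    boundaryIncl Y ξ = ((hY.rayTo x ξ).map isometry_subtype_coe).endpoint := by
  rw [← boundaryIncl_endpoint, hY.endpoint_rayTo]

lemma Ultrafilter.exists_eventually_eq {ι α : Type*} [Finite α] (𝒰 : Ultrafilter ι) (f : ι → α) :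
    ∃ a, ∀ᶠ k in (𝒰 : Filter ι), f k = a := by
  have h : ∀ᶠ k in (𝒰 : Filter ι), ∃ a, f k = a := Eventually.of_forall fun k => ⟨_, rfl⟩
  exact Ultrafilter.eventually_exists_iff.1 h

/-- A factor of the boundary with at least three points has no isolated points. -/
theorem IsJoinOfDiscrete.not_isOpen_singleton [ProperSpace X] (hX : IsCAT0 X)
    (hG : IsGeometricAction G X) {n : ℕ} {Y : Fin n → Set X} (h : IsJoinOfDiscrete Y)
    {i : Fin n} [ProperSpace (Y i)] (hY : IsCAT0 (Y i)) (hi : 3 ≤ ENat.card (Boundary (Y i)))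
    (x : Y i) (ξ : Boundary (Y i)) : ¬ IsOpen ({ξ} : Set (VisualBoundary (Y i) x)) := by
  intro hopen
  have hincl := fun ζ : Boundary (Y i) => hY.boundaryIncl_eq x ζ
  have hzero : ∀ ζ : Boundary (Y i),
      ((hY.rayTo x ζ).map isometry_subtype_coe : GeodesicRay X) 0 = (x : X) := fun ζ => by
    rw [GeodesicRay.map_apply, hY.rayTo_zero]
  have hinj : ∀ (j : Fin n) (η η' : Boundary (Y j)),
      boundaryIncl (Y j) η = boundaryIncl (Y j) η' → η = η' := by
    intro j η η' heq
    by_contra hne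
    have := h.titsAngle_boundaryIncl_of_ne hne
    rw [heq, hX.titsAngle_self] at this
    exact Real.pi_pos.ne this
  obtain ⟨C, hC⟩ := hG.exists_dist_smul_le (x : X)
  choose g hg using fun k : ℕ => hC ((hY.rayTo x ξ).map isometry_subtype_coe k)
  choose j hj hcard using fun k : ℕ => h.exists_apply_boundaryIncl_eq
    (hG.boundaryEquiv (g k)⁻¹) (hG.titsAngle_boundaryEquiv _) hi ξ
  obtain ⟨j₀, hj₀⟩ := (hyperfilter ℕ).exists_eventually_eq j
  have hcard₀ : 3 ≤ ENat.card (Boundary (Y j₀)) := by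
    obtain ⟨k, rfl⟩ := hj₀.exists
    exact hcard k
  have hβ : ∀ k, j k = j₀ → ∀ η : Boundary (Y j₀), ∃ β : Boundary (Y i),
      hG.boundaryEquiv (g k) (boundaryIncl (Y j₀) η) = boundaryIncl (Y i) β := by
    rintro k rfl η
    obtain ⟨m, ⟨β, hm⟩, -⟩ := h.exists_apply_boundaryIncl_eq
      (hG.boundaryEquiv (g k)) (hG.titsAngle_boundaryEquiv _) hcard₀ η
    obtain ⟨η₀, hη₀⟩ := hj k
    -- Points of different factors are at a right angle, whereas gₖη and ξ, coming from the one
    -- factor `j k`, are at angle 0 or π.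
    have hmi : m = i := by
      refine h.eq_of_cos_titsAngle_ne_zero (ξ := β) (η := ξ) fun h0 => ?_
      rw [← hm, ← hG.boundaryEquiv_inv_apply (g k) (boundaryIncl (Y i) ξ), hη₀,
        hG.titsAngle_boundaryEquiv, h.cos_titsAngle_boundaryIncl] at h0
      have := h.abs_cos_titsAngle (j k) η η₀
      rw [h0, abs_zero] at this
      exact zero_ne_one this
    subst hmi
    exact ⟨β, hm⟩
  have hβ' : ∃ β : ℕ → Boundary (Y j₀) → Boundary (Y i), ∀ k, j k = j₀ → ∀ η,
      hG.boundaryEquiv (g k) (boundaryIncl (Y j₀) η) = boundaryIncl (Y i) (β k η) := by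
    have : Nonempty (Boundary (Y i)) := ⟨ξ⟩
    choose! β hβ using hβ
    exact ⟨β, hβ⟩
  obtain ⟨β, hβ⟩ := hβ'
  choose ζ hζ using fun η : Boundary (Y j₀) =>
    hY.exists_tendsto_rayTo (hyperfilter ℕ) x fun k => β k η
  have hlim : ∀ η, ζ η = ξ → ∀ᶠ k in (hyperfilter ℕ : Filter ℕ), β k η = ξ := by
    intro η hη
    have ht := (hY.tendsto_visualBoundary_iff (f := fun k => β k η)).2 (hζ η)
    rw [hη] at ht
    exact ht (hopen.mem_nhds rfl)
  -- As `ξ` is isolated, convergence to it means equality for most `k`, and each gₖ is injective.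
  have heq : ∀ η η', ζ η = ξ → ζ η' = ξ → η = η' := by
    intro η η' h1 h2
    obtain ⟨k, hk, hk1, hk2⟩ := (hj₀.and ((hlim η h1).and (hlim η' h2))).exists
    apply hinj
    apply (hG.boundaryEquiv (g k)).injective
    rw [hβ k hk, hβ k hk, hk1, hk2]
  have hclose : ∀ η, ζ η ≠ ξ → ∀ (S : ℝ≥0) (κ : ℝ), 0 < κ → κ ≤ 1 →
      ∀ᶠ k in (hyperfilter ℕ : Filter ℕ), ∀ u, IsPointAt (x : X) ((g k)⁻¹ • (x : X)) S u →
        dist u (hX.rayTo x (boundaryIncl (Y j₀) η) S) ≤ 4 * S * κ := by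
    intro η hη S κ hκ0 hκ1
    refine hX.eventually_dist_le_of_titsAngle_eq_pi hG
      (σ := (hY.rayTo x ξ).map isometry_subtype_coe)
      (ρ := (hY.rayTo x (ζ η)).map isometry_subtype_coe)
      (ρ' := fun k => (hY.rayTo x (β k η)).map isometry_subtype_coe)
      (hzero _) (hzero _) (hX.rayTo_zero _ _) (fun k => hzero _)
      (fun T ε hε => hX.eventually_isPointAt_smul (hzero _) hg T hε)
      (fun T => (continuous_subtype_val.tendsto _).comp (hζ η T)) ?_ ?_ S hκ0 hκ1
    · filter_upwards [hj₀] with k hk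
      rw [hX.endpoint_rayTo, hβ k hk, hincl]
    · rw [← hincl, ← hincl]
      exact h.titsAngle_boundaryIncl_of_ne hη
  have hfar : ∀ S : ℝ≥0, ∀ᶠ k in (hyperfilter ℕ : Filter ℕ),
      ∃ u, IsPointAt (x : X) ((g k)⁻¹ • (x : X)) S u := by
    intro S
    filter_upwards [hX.eventually_isPointAt_smul (hzero ξ) hg S one_pos] with k hk
    obtain ⟨w, hw, -⟩ := hk
    refine hX.exists_isPointAt S.2 (hw.le.trans (le_of_eq ?_))
    have := (hG.isometry (g k)).dist_eq x ((g k)⁻¹ • (x : X))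
    rw [smul_inv_smul] at this
    rw [← this, dist_comm]
  -- Both η and η' are limits of gₖ⁻¹x. The value of κ below makes the two errors 4mκ add up to at
  -- most ε.
  have heq' : ∀ η η', ζ η ≠ ξ → ζ η' ≠ ξ → η = η' := by
    intro η η' h1 h2
    apply hinj
    refine hX.eq_of_rayTo_eq (x : X) fun m => dist_le_zero.1 ?_
    refine le_of_forall_pos_le_add fun ε hε => ?_
    have hm : (0 : ℝ) < 8 * m + ε + 1 := by positivity
    have hκ1 : ε / (8 * m + ε + 1) ≤ 1 := by
      rw [div_le_one hm]
      linarith [(Nat.cast_nonneg m : (0 : ℝ) ≤ m)]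
    obtain ⟨k, ⟨u, hu⟩, hk1, hk2⟩ := ((hfar m).and ((hclose η h1 m _ (div_pos hε hm) hκ1).and
      (hclose η' h2 m _ (div_pos hε hm) hκ1))).exists
    have e1 := hk1 u hu
    have e2 := hk2 u hu
    rw [NNReal.coe_natCast] at e1 e2
    have e3 : 8 * m * (ε / (8 * m + ε + 1)) ≤ ε := by
      rw [← mul_div_assoc, div_le_iff₀ hm]
      nlinarith
    have e4 := dist_triangle_left (hX.rayTo x (boundaryIncl (Y j₀) η) m)
      (hX.rayTo x (boundaryIncl (Y j₀) η') m) u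
    linarith
  have hne : Nonempty (Boundary (Y j₀)) := by
    rw [← ENat.one_le_card_iff_nonempty]
    exact le_trans (by norm_num) hcard₀
  obtain ⟨a⟩ := hne
  obtain ⟨b, hba, -⟩ := ENat.exists_ne_ne_of_three_le hcard₀ a a
  obtain ⟨c, hca, hcb⟩ := ENat.exists_ne_ne_of_three_le hcard₀ a b
  -- Pigeonhole: two of the three distinct points fall in the same case.
  by_cases ha : ζ a = ξ <;> by_cases hb : ζ b = ξ <;> by_cases hc : ζ c = ξ
  all_goals first
    | exact hba (heq b a hb ha)
    | exact hba (heq' b a hb ha)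
    | exact hca (heq c a hc ha)
    | exact hca (heq' c a hc ha)
    | exact hcb (heq c b hc hb)
    | exact hcb (heq' c b hc hb)

end Perfect

/-! ### Conclusion for zero-dimensional factors -/

theorem lemma3p6 {G X : Type*} [Group G] [MetricSpace X] [MulAction G X]
    (hX : IsCAT0 X) (hG : IsGeometricAction G X)
    {n : ℕ} (Y : Fin n → Set X)
    (hclosed : ∀ i, IsClosed (Y i)) (hconvex : ∀ i, IsGeodesicallyConvex (Y i))
    (hjoin : BoundaryIsJoin Y)
    (y : ∀ i, Y i)
    (hdim : ∀ i, smallInductiveDimension (VisualBoundary (Y i) (y i)) = 0)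
    (i : Fin n) (hcard : 3 ≤ ENat.card (Boundary (Y i))) :
    Nonempty (VisualBoundary (Y i) (y i) ≃ₜ cantorSet) := by
  have := hG.properSpace hX
  have hproper : ∀ i, ProperSpace (Y i) := fun i => .of_isClosed (hclosed i)
  have hY : ∀ i, IsCAT0 (Y i) := fun i => hX.subtype (hconvex i)
  have hbasis : ∀ i, TopologicalSpace.IsTopologicalBasis
      {s : Set (VisualBoundary (Y i) (y i)) | IsClopen s} := fun i =>
    hasSmallInductiveDimensionLT_one_iff.1 (smallInductiveDimension_le_iff.1 (hdim i).le)
  have := (hY i).compactSpace_visualBoundary (y i)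
  have ht2 := fun i => (hY i).t2Space_visualBoundary (y i)
  have := (hY i).secondCountable_visualBoundary (y i)
  have : Nonempty (VisualBoundary (Y i) (y i)) := by
    change Nonempty (Boundary (Y i))
    rw [← ENat.one_le_card_iff_nonempty]
    exact le_trans (by norm_num) hcard
  have h : IsJoinOfDiscrete Y :=
    { isJoin := hjoin
      titsAngle_self := fun i => (hY i).titsAngle_self
      -- Distinct points are separated by a clopen set, as the boundary is Hausdorff with a clopen
      -- basis. Every factor is needed here, not just the `i`-th, since group elements may permute
      -- factors.
      titsAngle_of_ne := by
        intro i ξ η hne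
        have hmem : (ξ : VisualBoundary (Y i) (y i)) ∈ ({η}ᶜ : Set (VisualBoundary (Y i) (y i))) :=
          hne
        obtain ⟨U, hU, hξU, hUη⟩ := (hbasis i).exists_subset_of_mem_open hmem
          isOpen_compl_singleton
        exact (hY i).titsAngle_eq_pi (y i) hU hξU fun hη => hUη hη rfl }
  exact nonempty_homeomorph_cantorSet (hbasis i)
    (h.not_isOpen_singleton hX hG (hY i) hcard (y i))
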